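/- Let $R$ be a Cohen–Macaulay (commutative, Noetherian) local ring with canonical module $\omega_R$, that is, a maximal Cohen–Macaulay module of type $1$ and of finite injective dimension; here a finitely generated $R$-module is called maximal Cohen–Macaulay if its depth equals $\dim R$, with the convention $\operatorname{depth} 0=+\infty$ (so the zero module is not maximal Cohen–Macaulay). For an $R$-module $X$ write $X^\vee=\operatorname{Hom}_R(X,\omega_R)$. Let $M$ and $N$ be finitely generated $R$-modules, with $N$ maximal Cohen–Macaulay, and let $n\ge 1$ be an integer. Suppose that for each $j=0,\dots,n-1$ the $R$-module $\operatorname{Tor}_j^R(M,N^\vee)$ is either zero or maximal Cohen–Macaulay. Then there are isomorphisms of $R$-modules $$\operatorname{Ext}^j_R(M,N)\cong \operatorname{Tor}_j^R(M,N^\vee)^\vee\qquad\text{for all } j=0,\dots,n.$$ In particular, $\operatorname{Ext}^j_R(M,N)^\vee\cong\operatorname{Tor}_j^R(M,N^\vee)$ for all $j=0,\dots,n-1$. There is also an exact sequence of $R$-modules $$0\to \operatorname{Ext}^1_R(\operatorname{Tor}_n^R(M,N^\vee),\omega_R)\to \operatorname{Ext}^{n+1}_R(M,N)\to \operatorname{Tor}_{n+1}^R(M,N^\vee)^\vee\to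 \operatorname{Ext}^2_R(\operatorname{Tor}_n^R(M,N^\vee),\omega_R)\to \operatorname{Ext}^{n+2}_R(M,N).$$ -/

import Mathlib

open CategoryTheory

universe u

noncomputable section

namespace CanonicalDuality

/-- The module `Ext^j_R(M, N)`: Mathlib's `Ext` in the category of `R`-modules, which carries
its `R`-module structure. -/
abbrev ExtMod (R : Type u) [CommRing R] (M N : Type u) [AddCommGroup M] [Module R M]
    [AddCommGroup N] [Module R N] (j : ℕ) : Type u :=
  Abelian.Ext.{u} (ModuleCat.of R M) (ModuleCat.of R N) j

/-- The module `Tor_j^R(M, N)`: the value at `M` of the `j`-th left derived functor of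
`- ⊗ N`, that is, the `j`-th homology of `F ⊗ N` for a projective resolution `F` of `M`. -/
abbrev TorMod (R : Type u) [CommRing R] (M N : Type u) [AddCommGroup M] [Module R M]
    [AddCommGroup N] [Module R N] (j : ℕ) : ModuleCat.{u} R :=
  ((Tor' (ModuleCat.{u} R) j).obj (ModuleCat.of R M)).obj (ModuleCat.of R N)

variable (R : Type u) [CommRing R] [IsLocalRing R]

/-- The depth of a module over a local ring with maximal ideal `m`: the supremum of the lengths
of the weakly regular sequences on `M` with entries in `m`. For `M` finite and non-zero, such
a sequence is automatically regular (`M ≠ (r₁, …, rₖ)M` by Nakayama), so this is the usual depth;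
for `M = 0` every sequence counts and the depth is `⊤`. -/
def depth (M : Type u) [AddCommGroup M] [Module R M] : ℕ∞ :=
  ⨆ (rs : List R) (_ : ∀ r ∈ rs, r ∈ IsLocalRing.maximalIdeal R)
    (_ : RingTheory.Sequence.IsWeaklyRegular M rs), (rs.length : ℕ∞)

/-- A maximal Cohen-Macaulay module over a local ring: a finite module whose depth is the Krull
dimension of the ring. Over a Noetherian local ring the zero module (of depth `⊤`) is not
maximal Cohen-Macaulay. -/
structure IsMaximalCohenMacaulay (M : Type u) [AddCommGroup M] [Module R M] : Prop where
  finite : Module.Finite R M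
  depth_eq : (depth R M : WithBot ℕ∞) = ringKrullDim R

/-- A Cohen-Macaulay local ring: a Noetherian local ring whose depth is its Krull dimension. -/
structure IsCohenMacaulayLocalRing : Prop where
  noetherian : IsNoetherianRing R
  depth_eq : (depth R R : WithBot ℕ∞) = ringKrullDim R

/-- The type of a module `M` of finite depth `t` over a local ring with residue field `k`: the
`k`-dimension of `Ext^t_R(k, M)`. Since `Ext^t_R(k, M)` is killed by the maximal ideal,
its dimension over `k` is its length over `R`. -/
def moduleType (M : Type u) [AddCommGroup M] [Module R M] : ℕ∞ :=
  Module.length R (ExtMod R (IsLocalRing.ResidueField R) M (depth R M).toNat)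

/-- A canonical module of a Cohen-Macaulay local ring: a maximal Cohen-Macaulay module of type 1
and of finite injective dimension. -/
structure IsCanonicalModule (ω : Type u) [AddCommGroup ω] [Module R ω] : Prop where
  maximalCohenMacaulay : IsMaximalCohenMacaulay R ω
  type_eq_one : moduleType R ω = 1
  finite_injectiveDimension : ∃ d : ℕ, HasInjectiveDimensionLE (ModuleCat.of R ω) d

end CanonicalDuality

end

/-! Let `P` be a projective resolution of `M`, `A = N^∨` and `C = P ⊗ A`, so that the homology of
`C` is `T_j = Tor_j(M, A)`. Biduality `N ≅ A^∨` and Hom-tensor adjunction give `Hom(P, N) ≅ Hom(C,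
ω)`, so `Ext(M, N)` is the cohomology of the dual of `C`. The terms of `C` are `Hom(-, ω)`-acyclic
because `A` is. The result is then the low-degree part of the spectral sequence `Ext^p(T_q, ω) ⇒
Ext^(p+q)(M, N)`, whose rows `q < n` are concentrated in `p = 0`. In place of a spectral sequence,
`duality_of_acyclic` uses `D_j = coker(C_(j+1) → C_j)`, `B_j = ker(C_j → D_j)` and the short exact
sequences `0 → T_(j+1) → D_(j+1) → B_j → 0` and `0 → B_j → C_j → D_j → 0`.

The inputs about `ω` are that a maximal Cohen-Macaulay `X` and its dual are acyclic and that `X →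
X^∨∨` is bijective. Acyclicity comes from Bass' bound on the injective dimension and Nakayama. For
biduality, dividing by a sequence of length `d = dim R` regular on `X`, `ω` and `R` turns `Hom(-,
ω)` into `Ext^d(-, ω)` on modules of finite length, where it preserves length because `ω` has type
1. Comparing lengths makes evaluation on `X^∨` bijective; hence the dual of `X → X^∨∨` is bijective,
and `bijective_of_bijective_extMap` removes the dual. -/

noncomputable section

/-! ### The contravariant long exact sequence of `Ext(-, W)` -/

namespace CanonicalDuality

open Abelian

variable {R : Type u} [CommRing R] {X Y Z : Type u} [AddCommGroup X] [Module R X]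
  [AddCommGroup Y] [Module R Y] [AddCommGroup Z] [Module R Z]

/-- The map induced on `Ext^k(-, W)` by a linear map. -/
def extMap (W : Type u) [AddCommGroup W] [Module R W] (f : X →ₗ[R] Y) (k : ℕ) :
    ExtMod R Y W k →ₗ[R] ExtMod R X W k :=
  (Ext.mk₀ (ModuleCat.ofHom f)).precompOfLinear R (ModuleCat.of R W) (zero_add k)

variable (W : Type u) [AddCommGroup W] [Module R W]

lemma extMap_apply (f : X →ₗ[R] Y) (k : ℕ) (x : ExtMod R Y W k) :
    extMap W f k x = (Ext.mk₀ (ModuleCat.ofHom f)).comp x (zero_add k) := rfl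

@[simp]
lemma extMap_id (k : ℕ) : extMap W (LinearMap.id : X →ₗ[R] X) k = LinearMap.id := by
  ext x
  simp [extMap_apply]

lemma extMap_comp (f : X →ₗ[R] Y) (g : Y →ₗ[R] Z) (k : ℕ) :
    extMap W (g ∘ₗ f) k = extMap W f k ∘ₗ extMap W g k := by
  ext x
  rw [LinearMap.comp_apply, extMap_apply, extMap_apply, extMap_apply, ModuleCat.ofHom_comp,
    Ext.mk₀_comp_mk₀_assoc]

lemma extMap_smul (r : R) (f : X →ₗ[R] Y) (k : ℕ) :
    extMap W (r • f) k = r • extMap W f k := by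
  ext x
  have : ModuleCat.ofHom (r • f) = r • ModuleCat.ofHom f := rfl
  simp [extMap_apply, this, Ext.mk₀_smul]

@[simp]
lemma extMap_zero (k : ℕ) : extMap W (0 : X →ₗ[R] Y) k = 0 := by
  simpa using extMap_smul W (0 : R) (0 : X →ₗ[R] Y) k

/-- A linear equivalence induces an equivalence on `Ext^k(-, W)`. -/
def extCongr (e : X ≃ₗ[R] Y) (k : ℕ) : ExtMod R X W k ≃ₗ[R] ExtMod R Y W k :=
  LinearEquiv.ofLinearMap (extMap W e.symm.toLinearMap k) (extMap W e.toLinearMap k)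
    (by rw [← extMap_comp]; simp) (by rw [← extMap_comp]; simp)

/-- `Ext^0(X, W)` is the module of linear maps. -/
def extZero (X W : Type u) [AddCommGroup X] [Module R X] [AddCommGroup W] [Module R W] :
    ExtMod R X W 0 ≃ₗ[R] (X →ₗ[R] W) :=
  Ext.linearEquiv₀ (R := R) ≪≫ₗ ModuleCat.homLinearEquiv

lemma extZero_symm_apply (f : X →ₗ[R] W) :
    (extZero X W).symm f = Ext.mk₀ (ModuleCat.ofHom f) := rfl

lemma extMap_extZero_symm (f : X →ₗ[R] Y) (g : Y →ₗ[R] W) :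
    extMap W f 0 ((extZero Y W).symm g) = (extZero X W).symm (g ∘ₗ f) := by
  simp [extMap_apply, extZero_symm_apply, ModuleCat.ofHom_comp]

lemma extZero_extMap (f : X →ₗ[R] Y) (x : ExtMod R Y W 0) :
    extZero X W (extMap W f 0 x) = extZero Y W x ∘ₗ f := by
  obtain ⟨g, rfl⟩ := (extZero Y W).symm.surjective x
  simp [extMap_extZero_symm]

lemma shortExact_of_exact {f : X →ₗ[R] Y} {g : Y →ₗ[R] Z} (hf : Function.Injective f)
    (hfg : Function.Exact f g) (hg : Function.Surjective g) :
    (ModuleCat.shortComplexOfCompEqZero f g hfg.linearMap_comp_eq_zero).ShortExact where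
  exact := ModuleCat.shortComplex_exact _ hfg
  mono_f := (ModuleCat.mono_iff_injective _).mpr hf
  epi_g := (ModuleCat.epi_iff_surjective _).mpr hg

section LongExactSequence

variable {f : X →ₗ[R] Y} {g : Y →ₗ[R] Z} (hf : Function.Injective f)
  (hfg : Function.Exact f g) (hg : Function.Surjective g)

/-- The connecting map `Ext^k(X, W) → Ext^(k+1)(Z, W)` of a short exact sequence
`0 → X → Y → Z → 0`. -/
def extConn (k : ℕ) : ExtMod R X W k →ₗ[R] ExtMod R Z W (k + 1) :=
  (shortExact_of_exact hf hfg hg).extClass.precompOfLinear R (ModuleCat.of R W) (add_comm 1 k)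

include hf hfg hg in
lemma extMap_exact (k : ℕ) : Function.Exact (extMap W g k) (extMap W f k) := by
  intro x
  refine ⟨fun hx ↦
    Ext.contravariant_sequence_exact₂ (shortExact_of_exact hf hfg hg) _ x hx, ?_⟩
  rintro ⟨y, rfl⟩
  rw [← LinearMap.comp_apply, ← extMap_comp, hfg.linearMap_comp_eq_zero]
  simp

lemma extMap_extConn_exact (k : ℕ) :
    Function.Exact (extMap W f k) (extConn W hf hfg hg k) := by
  intro x
  refine ⟨fun hx ↦
    Ext.contravariant_sequence_exact₁ (shortExact_of_exact hf hfg hg) _ x (add_comm 1 k) hx, ?_⟩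
  rintro ⟨y, rfl⟩
  exact (shortExact_of_exact hf hfg hg).extClass_comp_assoc (h := add_comm 1 k) y

lemma extConn_extMap_exact (k : ℕ) :
    Function.Exact (extConn W hf hfg hg k) (extMap W g (k + 1)) := by
  intro x
  refine ⟨fun hx ↦
    Ext.contravariant_sequence_exact₃ (shortExact_of_exact hf hfg hg) _ x hx (add_comm 1 k), ?_⟩
  rintro ⟨y, rfl⟩
  exact (shortExact_of_exact hf hfg hg).comp_extClass_assoc y (add_comm 1 k)

include hg in
lemma extMap_zero_injective : Function.Injective (extMap W g 0) := by
  have : Epi (ModuleCat.ofHom g) := (ModuleCat.epi_iff_surjective _).mpr hg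
  exact Ext.precomp_mk₀_injective_of_epi (ModuleCat.of R W) (ModuleCat.ofHom g)

include hf hfg hg in
lemma extMap_succ_injective {k : ℕ} (h : Subsingleton (ExtMod R X W k)) :
    Function.Injective (extMap W g (k + 1)) := by
  refine (injective_iff_map_eq_zero _).mpr fun x hx ↦ ?_
  obtain ⟨y, rfl⟩ := (extConn_extMap_exact W hf hfg hg k x).mp hx
  rw [Subsingleton.elim y 0, map_zero]

include hf hfg hg in
lemma extMap_surjective {k : ℕ} (h : Subsingleton (ExtMod R Z W (k + 1))) :
    Function.Surjective (extMap W f k) := fun x ↦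
  (extMap_extConn_exact W hf hfg hg k x).mp (Subsingleton.elim _ _)

lemma extConn_surjective {k : ℕ} (h : Subsingleton (ExtMod R Y W (k + 1))) :
    Function.Surjective (extConn W hf hfg hg k) := fun x ↦
  (extConn_extMap_exact W hf hfg hg k x).mp (Subsingleton.elim _ _)

lemma extConn_injective {k : ℕ} (h : Subsingleton (ExtMod R Y W k)) :
    Function.Injective (extConn W hf hfg hg k) := by
  refine (injective_iff_map_eq_zero _).mpr fun x hx ↦ ?_
  obtain ⟨y, rfl⟩ := (extMap_extConn_exact W hf hfg hg k x).mp hx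
  rw [Subsingleton.elim y 0, map_zero]

include hf hfg hg in
lemma subsingleton_ext_middle {k : ℕ} (h₁ : Subsingleton (ExtMod R X W k))
    (h₃ : Subsingleton (ExtMod R Z W k)) : Subsingleton (ExtMod R Y W k) := by
  refine subsingleton_of_forall_eq 0 fun y ↦ ?_
  obtain ⟨z, rfl⟩ := (extMap_exact W hf hfg hg k y).mp (Subsingleton.elim _ _)
  rw [Subsingleton.elim z 0, map_zero]

include hf hfg hg in
lemma subsingleton_ext_left {k : ℕ} (h₂ : Subsingleton (ExtMod R Y W k))
    (h₃ : Subsingleton (ExtMod R Z W (k + 1))) : Subsingleton (ExtMod R X W k) :=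
  (extMap_surjective W hf hfg hg h₃).subsingleton

include hf hfg hg in
lemma subsingleton_ext_right {k : ℕ} (h₁ : Subsingleton (ExtMod R X W k))
    (h₂ : Subsingleton (ExtMod R Y W (k + 1))) : Subsingleton (ExtMod R Z W (k + 1)) :=
  (extConn_surjective W hf hfg hg h₂).subsingleton

variable {X' Y' Z' : Type u} [AddCommGroup X'] [Module R X'] [AddCommGroup Y'] [Module R Y']
  [AddCommGroup Z'] [Module R Z'] {f' : X' →ₗ[R] Y'} {g' : Y' →ₗ[R] Z'}
  (hf' : Function.Injective f') (hfg' : Function.Exact f' g') (hg' : Function.Surjective g')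

lemma extConn_naturality {a : X →ₗ[R] X'} {b : Y →ₗ[R] Y'} {c : Z →ₗ[R] Z'}
    (hab : b ∘ₗ f = f' ∘ₗ a) (hbc : c ∘ₗ g = g' ∘ₗ b) (k : ℕ) (x : ExtMod R X' W k) :
    extConn W hf hfg hg k (extMap W a k x) =
      extMap W c (k + 1) (extConn W hf' hfg' hg' k x) := by
  let φ : ModuleCat.shortComplexOfCompEqZero f g hfg.linearMap_comp_eq_zero ⟶
      ModuleCat.shortComplexOfCompEqZero f' g' hfg'.linearMap_comp_eq_zero :=
    { τ₁ := ModuleCat.ofHom a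
      τ₂ := ModuleCat.ofHom b
      τ₃ := ModuleCat.ofHom c
      comm₁₂ := ModuleCat.hom_ext hab.symm
      comm₂₃ := ModuleCat.hom_ext hbc.symm }
  have h := ShortComplex.ShortExact.extClass_naturality (shortExact_of_exact hf hfg hg)
    (shortExact_of_exact hf' hfg' hg') φ
  have h₁ := Ext.comp_assoc (shortExact_of_exact hf hfg hg).extClass (Ext.mk₀ φ.τ₁) x
    (add_zero 1) (zero_add k) (by lia : 1 + 0 + k = k + 1)
  have h₂ := Ext.comp_assoc (Ext.mk₀ φ.τ₃) (shortExact_of_exact hf' hfg' hg').extClass x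
    (zero_add 1) (add_comm 1 k) (by lia : 0 + 1 + k = k + 1)
  rw [h] at h₁
  exact h₁.symm.trans h₂

end LongExactSequence

lemma subsingleton_extMod_of_projective [Module.Projective R X] (k : ℕ) :
    Subsingleton (ExtMod R X W (k + 1)) :=
  have : Projective (ModuleCat.of R X) := (IsProjective.iff_projective X).mp ‹_›
  Ext.subsingleton_of_projective _ _ k

end CanonicalDuality

end

/-! ### Duality for complexes of acyclic modules -/

noncomputable section

namespace CanonicalDuality

section Algebra

variable {R : Type*} [CommRing R] {A B C : Type*} [AddCommGroup A] [Module R A]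
  [AddCommGroup B] [Module R B] [AddCommGroup C] [Module R C]

lemma exists_comp_eq_of_ker_le {a : A →ₗ[R] B} (ha : Function.Surjective a) {h : A →ₗ[R] C}
    (hle : ∀ x, a x = 0 → h x = 0) : ∃ g : B →ₗ[R] C, ∀ x, g (a x) = h x := by
  refine ⟨(LinearMap.ker a).liftQ h (fun x hx ↦ hle x hx) ∘ₗ
    (a.quotKerEquivOfSurjective ha).symm.toLinearMap, fun x ↦ ?_⟩
  have : (a.quotKerEquivOfSurjective ha).symm (a x) = (LinearMap.ker a).mkQ x := by
    rw [LinearEquiv.symm_apply_eq]; rfl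
  rw [LinearMap.comp_apply, LinearEquiv.coe_coe, this]
  rfl

lemma exact_ker_subtype (p : A →ₗ[R] B) : Function.Exact (LinearMap.ker p).subtype p :=
  fun c ↦ by simp

end Algebra

variable (R : Type u) [CommRing R] (W : Type u) [AddCommGroup W] [Module R W]

/-- A module is `Hom(-, W)`-acyclic if `Ext^k(-, W)` vanishes on it for all `k > 0`. -/
def IsHomAcyclic (X : Type u) [AddCommGroup X] [Module R X] : Prop :=
  ∀ k, Subsingleton (ExtMod R X W (k + 1))

section Extension

variable {R W} {X Y Z : Type u} [AddCommGroup X] [Module R X]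
  [AddCommGroup Y] [Module R Y] [AddCommGroup Z] [Module R Z]

lemma IsHomAcyclic.congr (h : IsHomAcyclic R W X) (e : X ≃ₗ[R] Y) : IsHomAcyclic R W Y := fun k ↦
  have := h k
  (extCongr W e (k + 1)).symm.toEquiv.subsingleton

variable {f : X →ₗ[R] Y} {g : Y →ₗ[R] Z} (hf : Function.Injective f)
  (hfg : Function.Exact f g) (hg : Function.Surjective g)

include hf hfg hg in
lemma IsHomAcyclic.left (hY : IsHomAcyclic R W Y) (hZ : IsHomAcyclic R W Z) : IsHomAcyclic R W X :=
  fun k ↦ subsingleton_ext_left W hf hfg hg (hY k) (hZ (k + 1))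

include hf hfg hg in
lemma IsHomAcyclic.middle (hX : IsHomAcyclic R W X) (hZ : IsHomAcyclic R W Z) :
    IsHomAcyclic R W Y :=
  fun k ↦ subsingleton_ext_middle W hf hfg hg (hX k) (hZ k)

include hfg hg in
lemma exists_comp_eq_of_comp_eq_zero (φ : Y →ₗ[R] W) (hφ : φ ∘ₗ f = 0) :
    ∃ ψ : Z →ₗ[R] W, ψ ∘ₗ g = φ := by
  obtain ⟨ψ, hψ⟩ := exists_comp_eq_of_ker_le hg (h := φ) fun y hy ↦ by
    obtain ⟨x, rfl⟩ := (hfg y).mp hy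
    exact LinearMap.congr_fun hφ x
  exact ⟨ψ, LinearMap.ext hψ⟩

end Extension

section FourTerm

variable {R} {T D' C D E : Type u} [AddCommGroup T] [Module R T] [AddCommGroup D'] [Module R D']
  [AddCommGroup C] [Module R C] [AddCommGroup D] [Module R D] [AddCommGroup E] [Module R E]
  {τ : T →ₗ[R] D'} {ι : D' →ₗ[R] C} {p : C →ₗ[R] D}

/-- The corestriction of `ι` to the kernel of `p`, for an exact pair `ι`, `p`. -/
def toKer (h₂ : Function.Exact ι p) : D' →ₗ[R] LinearMap.ker p :=
  ι.codRestrict _ h₂.apply_apply_eq_zero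

lemma toKer_surjective (h₂ : Function.Exact ι p) : Function.Surjective (toKer h₂) := by
  rintro ⟨c, hc⟩
  obtain ⟨d, rfl⟩ := (h₂ c).mp hc
  exact ⟨d, rfl⟩

lemma exact_toKer (h₁ : Function.Exact τ ι) (h₂ : Function.Exact ι p) :
    Function.Exact τ (toKer h₂) := fun d ↦ by
  rw [← h₁ d, ← Subtype.coe_inj]; rfl

variable {W} (hτ : Function.Injective τ) (h₁ : Function.Exact τ ι) (h₂ : Function.Exact ι p)
  (hp : Function.Surjective p)
  {π : (D' →ₗ[R] W) →ₗ[R] E} (hπ : Function.Surjective π)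
  (hker : ∀ φ, π φ = 0 ↔ ∃ ψ : C →ₗ[R] W, ψ ∘ₗ ι = φ)

include hp in
lemma IsHomAcyclic.ker (hC : IsHomAcyclic R W C) (hD : IsHomAcyclic R W D) :
    IsHomAcyclic R W (LinearMap.ker p) :=
  hC.left (Submodule.injective_subtype _) (exact_ker_subtype p) hp hD

include h₁ h₂ hp hπ hker in
/-- If `0 → T → D' → C → D → 0` is exact, then the cokernel of `Hom(C, W) → Hom(D', W)` is an
extension of a submodule of `Hom(T, W)` by `Ext^1(D, W)`, provided that `Ext^1(C, W) = 0`. -/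
lemma exists_cokernel_extension (hC : Subsingleton (ExtMod R C W 1)) :
    ∃ (g₁ : ExtMod R D W 1 →ₗ[R] E) (g₂ : E →ₗ[R] (T →ₗ[R] W)),
      Function.Injective g₁ ∧ Function.Exact g₁ g₂ ∧ ∀ φ, g₂ (π φ) = φ ∘ₗ τ := by
  have hi := Submodule.injective_subtype (LinearMap.ker p)
  let δ := extConn W hi (exact_ker_subtype p) hp 0
  have hδ : Function.Surjective δ := extConn_surjective W _ _ _ hC
  let h : ExtMod R (LinearMap.ker p) W 0 →ₗ[R] E :=
    π ∘ₗ (toKer h₂).lcomp R W ∘ₗ (extZero (R := R) _ W).toLinearMap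
  have hh (x) : h x = π (extZero (R := R) _ W x ∘ₗ toKer h₂) := rfl
  -- Both conditions say that the form on `ker p` extends to `C`. Hence `h` factors through `δ` as
  -- an injective map `g₁`.
  have key (x) : h x = 0 ↔ δ x = 0 := by
    rw [hh, hker, extMap_extConn_exact W hi (exact_ker_subtype p) hp 0 x]
    constructor
    · rintro ⟨ψ, hψ⟩
      refine ⟨(extZero C W).symm ψ, ?_⟩
      rw [extMap_extZero_symm, LinearEquiv.symm_apply_eq]
      ext ⟨c, hc⟩
      obtain ⟨d, rfl⟩ := (h₂ c).mp hc
      exact LinearMap.congr_fun hψ d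
    · rintro ⟨y, rfl⟩
      refine ⟨extZero C W y, ?_⟩
      rw [extZero_extMap]
      rfl
  obtain ⟨g₁, hg₁⟩ := exists_comp_eq_of_ker_le hδ (h := h) fun x hx ↦ (key x).mpr hx
  obtain ⟨g₂, hg₂⟩ := exists_comp_eq_of_ker_le hπ (h := τ.lcomp R W) fun φ hφ ↦ by
    obtain ⟨ψ, rfl⟩ := (hker φ).mp hφ
    ext t
    simp [h₁.apply_apply_eq_zero]
  refine ⟨g₁, g₂, (injective_iff_map_eq_zero _).mpr fun y hy ↦ ?_, fun e ↦ ⟨fun he ↦ ?_, ?_⟩, hg₂⟩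
  · obtain ⟨x, rfl⟩ := hδ y
    rwa [hg₁, key] at hy
  · obtain ⟨φ, rfl⟩ := hπ e
    rw [hg₂] at he
    obtain ⟨ψ, rfl⟩ := exists_comp_eq_of_comp_eq_zero (exact_toKer h₁ h₂)
      (toKer_surjective h₂) φ he
    refine ⟨δ ((extZero _ W).symm ψ), ?_⟩
    rw [hg₁, hh, LinearEquiv.apply_symm_apply]
  · rintro ⟨y, rfl⟩
    obtain ⟨x, rfl⟩ := hδ y
    rw [hg₁, hh, hg₂]
    ext t
    have : toKer h₂ (τ t) = 0 := (exact_toKer h₁ h₂).apply_apply_eq_zero t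
    simp [this]

end FourTerm

section Complex

variable {R W} {C D T E : ℕ → Type u} [∀ j, AddCommGroup (C j)] [∀ j, Module R (C j)]
  [∀ j, AddCommGroup (D j)] [∀ j, Module R (D j)] [∀ j, AddCommGroup (T j)] [∀ j, Module R (T j)]
  [∀ j, AddCommGroup (E j)] [∀ j, Module R (E j)]
  {τ : ∀ j, T (j + 1) →ₗ[R] D (j + 1)} {ι : ∀ j, D (j + 1) →ₗ[R] C j} {p : ∀ j, C j →ₗ[R] D j}
  {π : ∀ j, (D (j + 1) →ₗ[R] W) →ₗ[R] E (j + 1)}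
  (hτ : ∀ j, Function.Injective (τ j)) (h₁ : ∀ j, Function.Exact (τ j) (ι j))
  (h₂ : ∀ j, Function.Exact (ι j) (p j)) (hp : ∀ j, Function.Surjective (p j))
  (hπ : ∀ j, Function.Surjective (π j))
  (hker : ∀ j φ, π j φ = 0 ↔ ∃ ψ : C j →ₗ[R] W, ψ ∘ₗ ι j = φ)
  (eT : T 0 ≃ₗ[R] D 0) (hC : ∀ j, IsHomAcyclic R W (C j))

-- Acyclicity climbs the complex from `D 0 ≅ T 0`: `ker (p j)` is acyclic as the kernel of a
-- surjection of acyclic modules, and `D (j + 1)` is an extension of it by `T (j + 1)`.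
include hτ h₁ h₂ hp eT hC in
lemma isHomAcyclic_of_lt {n : ℕ} (hT : ∀ j < n, IsHomAcyclic R W (T j)) :
    ∀ j < n, IsHomAcyclic R W (D j) := by
  intro j
  induction j with
  | zero => exact fun h ↦ (hT 0 h).congr eT
  | succ j ih =>
    intro h
    exact (hT (j + 1) h).middle (hτ j) (exact_toKer (h₁ j) (h₂ j)) (toKer_surjective _)
      (IsHomAcyclic.ker (hp j) (hC j) (ih (by lia)))

include hτ h₁ h₂ hp hπ hker eT hC in
/-- Low-degree part of the spectral sequence `Ext^p(H_q(C), W) ⇒ H^(p+q)(Hom(C, W))` for a chain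
complex `C` of `Hom(-, W)`-acyclic modules whose homology modules `T j` are acyclic for `j < n`.
Here `D j` is the cokernel of `C (j + 1) → C j`. -/
theorem duality_of_acyclic (eE : E 0 ≃ₗ[R] (D 0 →ₗ[R] W)) {n : ℕ} (hn : 1 ≤ n)
    (hT : ∀ j < n, IsHomAcyclic R W (T j)) :
    (∀ j ≤ n, Nonempty (E j ≃ₗ[R] (T j →ₗ[R] W))) ∧
    ∃ (f₁ : ExtMod R (T n) W 1 →ₗ[R] E (n + 1)) (f₂ : E (n + 1) →ₗ[R] (T (n + 1) →ₗ[R] W))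
      (f₃ : (T (n + 1) →ₗ[R] W) →ₗ[R] ExtMod R (T n) W 2)
      (f₄ : ExtMod R (T n) W 2 →ₗ[R] E (n + 2)),
      Function.Injective f₁ ∧ Function.Exact f₁ f₂ ∧ Function.Exact f₂ f₃ ∧
        Function.Exact f₃ f₄ := by
  have hD := isHomAcyclic_of_lt hτ h₁ h₂ hp eT hC hT
  have hB (j) (hj : j < n) : IsHomAcyclic R W (LinearMap.ker (p j)) :=
    IsHomAcyclic.ker (hp j) (hC j) (hD j hj)
  have hi (j) := Submodule.injective_subtype (LinearMap.ker (p j))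
  choose g₁ g₂ hg₁ hg₁₂ hg₂ using fun j ↦
    exists_cokernel_extension (h₁ j) (h₂ j) (hp j) (hπ j) (hker j) (hC j 0)
  refine ⟨fun j hj ↦ ?_, ?_⟩
  · obtain _ | j := j
    · exact ⟨eE ≪≫ₗ LinearEquiv.congrLeft W R eT.symm⟩
    -- The kernel of `g₂ j` is `Ext^1(D j, W) = 0`; forms on `T (j + 1)` extend to `D (j + 1)`
    -- because `Ext^1(ker (p j), W) = 0`.
    · refine ⟨LinearEquiv.ofBijective (g₂ j) ⟨(injective_iff_map_eq_zero _).mpr fun e he ↦ ?_,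
        fun φ ↦ ?_⟩⟩
      · obtain ⟨x, rfl⟩ := (hg₁₂ j e).mp he
        have := hD j (by lia) 0
        rw [Subsingleton.elim x 0, map_zero]
      · obtain ⟨y, hy⟩ := extMap_surjective W (hτ j) (exact_toKer (h₁ j) (h₂ j))
          (toKer_surjective _) (hB j (by lia) 0) ((extZero _ W).symm φ)
        refine ⟨π j (extZero _ W y), ?_⟩
        rw [hg₂, ← extZero_extMap, hy, LinearEquiv.apply_symm_apply]
  · obtain ⟨m, rfl⟩ : ∃ m, n = m + 1 := ⟨n - 1, by lia⟩
    -- Since `m < n`, `ker (p m)` is acyclic, so `D n` and `T n` have the same `Ext` in positive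
    -- degrees.
    have hbij (k) : Function.Bijective (extMap W (τ m) (k + 1)) := by
      refine ⟨(injective_iff_map_eq_zero _).mpr fun x hx ↦ ?_, ?_⟩
      · obtain ⟨y, rfl⟩ := (extMap_exact W (hτ m) (exact_toKer (h₁ m) (h₂ m))
          (toKer_surjective _) (k + 1) x).mp hx
        have := hB m (by lia) k
        rw [Subsingleton.elim y 0, map_zero]
      · exact extMap_surjective W (hτ m) (exact_toKer (h₁ m) (h₂ m)) (toKer_surjective _)
          (hB m (by lia) (k + 1))
    let e (k) := LinearEquiv.ofBijective _ (hbij k)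
    let δ := extConn W (hi (m + 1)) (exact_ker_subtype (p (m + 1))) (hp (m + 1)) 1
    let eδ : ExtMod R (LinearMap.ker (p (m + 1))) W 1 ≃ₗ[R] ExtMod R (D (m + 1)) W 2 :=
      LinearEquiv.ofBijective δ ⟨extConn_injective W _ _ _ (hC (m + 1) 0),
        extConn_surjective W _ _ _ (hC (m + 1) 1)⟩
    have hex := exact_toKer (h₁ (m + 1)) (h₂ (m + 1))
    have hsu := toKer_surjective (h₂ (m + 1))
    -- With `B = ker (p n)`, `Ext^1(B, W) ≅ Ext^2(D n, W) ≅ Ext^2(T n, W)`. The required sequence is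
    -- then the one of `0 → T (n + 1) → D (n + 1) → B → 0`, followed by the inclusion of `Ext^1(D (n
    -- + 1), W)` in `E (n + 2)`.
    let ε : ExtMod R (LinearMap.ker (p (m + 1))) W 1 ≃ₗ[R] ExtMod R (T (m + 1)) W 2 :=
      eδ ≪≫ₗ e 1
    let c := extConn W (hτ (m + 1)) hex hsu 0
    refine ⟨g₁ (m + 1) ∘ₗ (e 0).symm.toLinearMap, g₂ (m + 1),
      ε.toLinearMap ∘ₗ c ∘ₗ (extZero _ W).symm.toLinearMap,
      g₁ (m + 2) ∘ₗ extMap W (toKer (h₂ (m + 1))) 1 ∘ₗ ε.symm.toLinearMap, ?_, ?_, ?_, ?_⟩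
    · exact (hg₁ (m + 1)).comp (e 0).symm.injective
    · intro x
      rw [hg₁₂ (m + 1) x]
      simp only [Set.mem_range, LinearMap.comp_apply]
      exact (e 0).symm.surjective.exists
    · intro φ
      rw [LinearMap.comp_apply, LinearMap.comp_apply, LinearEquiv.coe_coe, LinearEquiv.coe_coe,
        LinearEquiv.map_eq_zero_iff, extMap_extConn_exact W (hτ (m + 1)) hex hsu 0]
      constructor
      · rintro ⟨y, hy⟩
        refine ⟨π (m + 1) (extZero _ W y), ?_⟩
        rw [hg₂, ← extZero_extMap, hy, LinearEquiv.apply_symm_apply]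
      · rintro ⟨x, rfl⟩
        obtain ⟨ψ, rfl⟩ := hπ _ x
        refine ⟨(extZero _ W).symm ψ, ?_⟩
        rw [extMap_extZero_symm, hg₂]
    · intro x
      obtain ⟨x, rfl⟩ := ε.surjective x
      rw [LinearMap.comp_apply, LinearMap.comp_apply, LinearEquiv.coe_coe,
        LinearEquiv.symm_apply_apply, map_eq_zero_iff _ (hg₁ _),
        extConn_extMap_exact W (hτ (m + 1)) hex hsu 0]
      constructor
      · rintro ⟨y, rfl⟩
        exact ⟨extZero _ W y, by simp [c]⟩
      · rintro ⟨y, hy⟩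
        exact ⟨(extZero _ W).symm y, ε.injective hy⟩

end Complex

end CanonicalDuality

end

/-! ### Comparing `Ext(M, Hom(A, W))` with the dual of `P ⊗ A` -/

noncomputable section

namespace CanonicalDuality

open Abelian TensorProduct

section Tensor

variable {R : Type u} [CommRing R] {W : Type u} [AddCommGroup W] [Module R W]
  (P : Type u) [AddCommGroup P] [Module R P] [Module.Projective R P]
  {G A : Type u} [AddCommGroup G] [Module R G]
  [Module.Projective R G] [AddCommGroup A] [Module R A]

/-- As `P ⊗ G` is projective, it suffices to extend forms from `P ⊗ ker g` to `P ⊗ G`. By currying,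
this lifts a map from the projective `P` along `Hom(G, W) → Hom(ker g, W)`, which is surjective
because `Ext^1(A, W) = 0`. -/
lemma subsingleton_ext_one_tensor {g : G →ₗ[R] A} (hg : Function.Surjective g)
    (hA : Subsingleton (ExtMod R A W 1)) : Subsingleton (ExtMod R (P ⊗[R] A) W 1) := by
  have hi := Submodule.injective_subtype (LinearMap.ker g)
  have hex := exact_ker_subtype g
  have hPi := Module.Flat.lTensor_preserves_injective_linearMap (M := P) _ hi
  have hPe := lTensor_exact P hex hg
  have hPg := LinearMap.lTensor_surjective P hg
  have hsurj := extConn_surjective W hPi hPe hPg (k := 0)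
    (subsingleton_extMod_of_projective W 0)
  refine subsingleton_of_forall_eq 0 fun x ↦ ?_
  obtain ⟨x, rfl⟩ := hsurj x
  rw [extMap_extConn_exact W hPi hPe hPg 0]
  obtain ⟨φ, rfl⟩ := (extZero _ W).symm.surjective x
  have hres : Function.Surjective ((LinearMap.ker g).subtype.lcomp R W) := by
    intro ψ
    obtain ⟨y, hy⟩ := extMap_surjective W hi hex hg hA ((extZero _ W).symm ψ)
    refine ⟨extZero _ W y, ?_⟩
    rw [LinearMap.lcomp_apply', ← extZero_extMap, hy, LinearEquiv.apply_symm_apply]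
  obtain ⟨θ, hθ⟩ := Module.projective_lifting_property _ (TensorProduct.curry φ) hres
  refine ⟨(extZero _ W).symm (TensorProduct.lift θ), ?_⟩
  rw [extMap_extZero_symm]
  congr 1
  refine TensorProduct.ext' fun p a ↦ ?_
  exact LinearMap.congr_fun (LinearMap.congr_fun hθ p) a

lemma subsingleton_ext_succ_tensor {g : G →ₗ[R] A} (hg : Function.Surjective g) {k : ℕ}
    (hK : Subsingleton (ExtMod R (P ⊗[R] LinearMap.ker g) W k)) :
    Subsingleton (ExtMod R (P ⊗[R] A) W (k + 1)) :=
  subsingleton_ext_right W (Module.Flat.lTensor_preserves_injective_linearMap (M := P) _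
    (Submodule.injective_subtype (LinearMap.ker g))) (lTensor_exact P (exact_ker_subtype g) hg)
    (LinearMap.lTensor_surjective P hg) hK (subsingleton_extMod_of_projective W _)

variable (R A) in
lemma exists_projective_presentation : ∃ (G : Type u) (_ : AddCommGroup G) (_ : Module R G)
    (_ : Module.Projective R G) (g : G →ₗ[R] A), Function.Surjective g :=
  ⟨A →₀ R, inferInstance, inferInstance, inferInstance, Finsupp.linearCombination R id,
    Finsupp.linearCombination_id_surjective R A⟩

-- Dimension shifting: the kernel of a projective presentation of `A` is again acyclic, and
-- tensoring with the flat module `P` keeps the presentation exact.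
omit [AddCommGroup A] [Module R A] in
lemma IsHomAcyclic.tensor [AddCommGroup A] [Module R A] (hA : IsHomAcyclic R W A) :
    IsHomAcyclic R W (P ⊗[R] A) := by
  intro k
  induction k generalizing A with
  | zero =>
    obtain ⟨G, _, _, _, g, hg⟩ := exists_projective_presentation R A
    exact subsingleton_ext_one_tensor P hg (hA 0)
  | succ k ih =>
    obtain ⟨G, _, _, _, g, hg⟩ := exists_projective_presentation R A
    have hG : IsHomAcyclic R W G := fun k ↦ subsingleton_extMod_of_projective W k
    exact subsingleton_ext_succ_tensor P hg (ih (IsHomAcyclic.ker hg hG hA))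

end Tensor

section Opcycles

variable {R : Type u} [CommRing R] (K : ChainComplex (ModuleCat.{u} R) ℕ)

lemma exact_fromOpcycles_pOpcycles (j : ℕ) :
    Function.Exact (K.fromOpcycles (j + 1) j).hom (K.pOpcycles j).hom := by
  have h : (ShortComplex.mk _ _ (K.d_pOpcycles (j + 1) j)).Exact :=
    ShortComplex.exact_of_g_is_cokernel _ (K.opcyclesIsCokernel (j + 1) j (by simp))
  have h' : Function.Exact (K.d (j + 1) j).hom (K.pOpcycles j).hom :=
    (ShortComplex.ShortExact.moduleCat_exact_iff_function_exact _).mp h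
  have hs : Function.Surjective (K.pOpcycles (j + 1)).hom :=
    (ModuleCat.epi_iff_surjective _).mp inferInstance
  intro x
  rw [h' x, ← K.p_fromOpcycles (j + 1) j]
  simp only [Set.mem_range, ModuleCat.hom_comp, LinearMap.comp_apply]
  exact (hs.exists (p := fun y ↦ (K.fromOpcycles (j + 1) j).hom y = x)).symm

lemma exact_homologyι_fromOpcycles (j : ℕ) :
    Function.Exact (K.homologyι (j + 1)).hom (K.fromOpcycles (j + 1) j).hom := by
  have h : (ShortComplex.mk _ _ (K.homologyι_comp_fromOpcycles (j + 1) j)).Exact :=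
    ShortComplex.exact_of_f_is_kernel _ (K.homologyIsKernel (j + 1) j (by simp))
  exact (ShortComplex.ShortExact.moduleCat_exact_iff_function_exact _).mp h

lemma pOpcycles_surjective (j : ℕ) : Function.Surjective (K.pOpcycles j).hom :=
  (ModuleCat.epi_iff_surjective _).mp inferInstance

lemma homologyι_injective (j : ℕ) : Function.Injective (K.homologyι j).hom :=
  (ModuleCat.mono_iff_injective _).mp inferInstance

end Opcycles

section Resolution

variable {R : Type u} [CommRing R] {M : Type u} [AddCommGroup M] [Module R M]
  (N : Type u) [AddCommGroup N] [Module R N] (P : ProjectiveResolution (ModuleCat.of R M))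

lemma smul_extMk {Y : ModuleCat.{u} R} {j : ℕ} (r : R) (f : P.complex.X j ⟶ Y)
    (hf : P.complex.d (j + 1) j ≫ f = 0) (hf' : P.complex.d (j + 1) j ≫ (r • f) = 0) :
    P.extMk (r • f) (j + 1) rfl hf' = (r • P.extMk f (j + 1) rfl hf : Ext.{u} _ Y j) := by
  rw [Ext.smul_eq_comp_mk₀, P.extMk_comp_mk₀]
  congr 1

/-- The surjection from the module of `N`-valued `j`-cocycles of a projective resolution of `M`
to `Ext^j(M, N)`. -/
def extOfCocycle (j : ℕ) :
    LinearMap.ker ((P.complex.d (j + 1) j).hom.lcomp R N) →ₗ[R] ExtMod R M N j where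
  toFun f := P.extMk (Y := ModuleCat.of R N) (ModuleCat.ofHom f.1) (j + 1) rfl
    (ModuleCat.hom_ext (LinearMap.mem_ker.mp f.2))
  map_add' f g := (P.add_extMk (Y := ModuleCat.of R N) (ModuleCat.ofHom f.1) (ModuleCat.ofHom g.1)
    (j + 1) rfl (ModuleCat.hom_ext (LinearMap.mem_ker.mp f.2))
    (ModuleCat.hom_ext (LinearMap.mem_ker.mp g.2))).symm
  map_smul' r f := smul_extMk P (Y := ModuleCat.of R N) r (ModuleCat.ofHom f.1)
    (ModuleCat.hom_ext (LinearMap.mem_ker.mp f.2))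
    (ModuleCat.hom_ext (LinearMap.mem_ker.mp (r • f).2))

lemma extOfCocycle_surjective (j : ℕ) : Function.Surjective (extOfCocycle N P j) := fun x ↦ by
  obtain ⟨f, hf, rfl⟩ := P.extMk_surjective x (j + 1) rfl
  exact ⟨⟨f.hom, congr_arg ModuleCat.Hom.hom hf⟩, rfl⟩

lemma extOfCocycle_eq_zero_iff (j : ℕ)
    (f : LinearMap.ker ((P.complex.d (j + 1 + 1) (j + 1)).hom.lcomp R N)) :
    extOfCocycle N P (j + 1) f = 0 ↔
      ∃ g : P.complex.X j →ₗ[R] N, g ∘ₗ (P.complex.d (j + 1) j).hom = f.1 := by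
  refine (P.extMk_eq_zero_iff (Y := ModuleCat.of R N) (ModuleCat.ofHom f.1) _ rfl
    (ModuleCat.hom_ext (LinearMap.mem_ker.mp f.2)) j rfl).trans ⟨?_, ?_⟩
  · rintro ⟨g, hg⟩
    exact ⟨g.hom, congr_arg ModuleCat.Hom.hom hg⟩
  · rintro ⟨g, hg⟩
    exact ⟨ModuleCat.ofHom g, ModuleCat.hom_ext hg⟩

variable {N} {W A : Type u} [AddCommGroup W] [Module R W] [AddCommGroup A] [Module R A]
  (e : N ≃ₗ[R] (A →ₗ[R] W))

/-- Hom-tensor adjunction, for a module `N` identified with `Hom(A, W)`. -/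
def curryEquiv (X : Type u) [AddCommGroup X] [Module R X] :
    (X ⊗[R] A →ₗ[R] W) ≃ₗ[R] (X →ₗ[R] N) :=
  (TensorProduct.lift.equiv (.id R) X A W).symm ≪≫ₗ LinearEquiv.congrRight e.symm

lemma curryEquiv_comp {X Y : Type u} [AddCommGroup X] [Module R X] [AddCommGroup Y] [Module R Y]
    (f : X →ₗ[R] Y) (φ : Y ⊗[R] A →ₗ[R] W) :
    curryEquiv e X (φ ∘ₗ f.rTensor A) = curryEquiv e Y φ ∘ₗ f := by
  ext x
  refine congr_arg e.symm (LinearMap.ext fun a ↦ ?_)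
  rfl

/-- The tensor product of a projective resolution with a module. -/
def tensorComplex (A : Type u) [AddCommGroup A] [Module R A] : ChainComplex (ModuleCat.{u} R) ℕ :=
  (((MonoidalCategory.tensoringRight (ModuleCat.{u} R)).obj
    (ModuleCat.of R A)).mapHomologicalComplex _).obj P.complex

/-- The homology of `P ⊗ A` is `Tor`. -/
def torEquiv (A : Type u) [AddCommGroup A] [Module R A] (j : ℕ) :
    TorMod R M A j ≃ₗ[R] (tensorComplex P A).homology j :=
  (P.isoLeftDerivedObj ((MonoidalCategory.tensoringRight (ModuleCat.{u} R)).obj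
    (ModuleCat.of R A)) j).toLinearEquiv

/-- `Tor_0(M, A)` is the tensor product. -/
def torZeroEquiv (M A : Type u) [AddCommGroup M] [Module R M] [AddCommGroup A] [Module R A] :
    TorMod R M A 0 ≃ₗ[R] M ⊗[R] A :=
  (((MonoidalCategory.tensoringRight (ModuleCat.{u} R)).obj
    (ModuleCat.of R A)).leftDerivedZeroIsoSelf.app (ModuleCat.of R M)).toLinearEquiv

lemma isHomAcyclic_tensorComplex (hA : IsHomAcyclic R W A) (j : ℕ) :
    IsHomAcyclic R W ((tensorComplex P A).X j) :=
  have : Module.Projective R (P.complex.X j) := by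
    rw [IsProjective.iff_projective]; exact P.projective j
  hA.tensor (P.complex.X j)

/-- The adjunction between `Hom(P ⊗ A, W)` and `Hom(P, Hom(A, W))` in degree `j`. -/
def cochainEquiv (j : ℕ) :
    ((tensorComplex P A).X j →ₗ[R] W) ≃ₗ[R] (P.complex.X j →ₗ[R] N) :=
  curryEquiv e (P.complex.X j)

lemma cochainEquiv_comp_d (i j : ℕ) (φ : (tensorComplex P A).X j →ₗ[R] W) :
    cochainEquiv P e i (φ ∘ₗ ((tensorComplex P A).d i j).hom) =
      cochainEquiv P e j φ ∘ₗ (P.complex.d i j).hom :=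
  curryEquiv_comp e (P.complex.d i j).hom φ

/-- A linear form on the cokernel of `C (j + 1) → C j`, where `C = P ⊗ A`, viewed as a
cocycle with values in `N = Hom(A, W)`. -/
def opcyclesToCocycle (j : ℕ) : ((tensorComplex P A).opcycles j →ₗ[R] W) →ₗ[R]
    LinearMap.ker ((P.complex.d (j + 1) j).hom.lcomp R N) :=
  ((cochainEquiv P e j).toLinearMap ∘ₗ
    ((tensorComplex P A).pOpcycles j).hom.lcomp R W).codRestrict _ fun φ ↦ by
      have : ((tensorComplex P A).pOpcycles j).hom ∘ₗ ((tensorComplex P A).d (j + 1) j).hom = 0 :=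
        congr_arg ModuleCat.Hom.hom ((tensorComplex P A).d_pOpcycles (j + 1) j)
      rw [LinearMap.mem_ker, LinearMap.lcomp_apply', LinearMap.comp_apply, LinearEquiv.coe_coe,
        ← cochainEquiv_comp_d, LinearMap.lcomp_apply', LinearMap.comp_assoc, this,
        LinearMap.comp_zero, map_zero]

/-- Under the adjunction a cocycle is a form on `P_j ⊗ A` killing boundaries, so it descends to the
cokernel. -/
lemma opcyclesToCocycle_surjective (j : ℕ) :
    Function.Surjective (opcyclesToCocycle P e j) := by
  rintro ⟨f, hf⟩
  obtain ⟨φ, rfl⟩ := (cochainEquiv P e j).surjective f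
  rw [LinearMap.mem_ker, LinearMap.lcomp_apply', ← cochainEquiv_comp_d,
    LinearEquiv.map_eq_zero_iff] at hf
  have hf' : (tensorComplex P A).d (j + 1) j ≫ ModuleCat.ofHom φ = 0 := ModuleCat.hom_ext hf
  refine ⟨((tensorComplex P A).descOpcycles (ModuleCat.ofHom φ) (j + 1) (by simp) hf').hom,
    Subtype.ext (congr_arg (cochainEquiv P e j) ?_)⟩
  exact congr_arg ModuleCat.Hom.hom
    ((tensorComplex P A).p_descOpcycles (ModuleCat.ofHom φ) (j + 1) (by simp) hf')

lemma extOfCocycle_opcyclesToCocycle_eq_zero_iff (j : ℕ)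
    (φ : (tensorComplex P A).opcycles (j + 1) →ₗ[R] W) :
    extOfCocycle N P (j + 1) (opcyclesToCocycle P e (j + 1) φ) = 0 ↔
      ∃ ψ : (tensorComplex P A).X j →ₗ[R] W,
        ψ ∘ₗ ((tensorComplex P A).fromOpcycles (j + 1) j).hom = φ := by
  rw [extOfCocycle_eq_zero_iff]
  refine (cochainEquiv P e j).surjective.exists.trans (exists_congr fun ψ ↦ ?_)
  rw [← cochainEquiv_comp_d, ← (tensorComplex P A).p_fromOpcycles (j + 1) j]
  -- The adjunction turns coboundaries into forms composed with the differential; the surjection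
  -- onto opcycles is then cancelled.
  refine ((cochainEquiv P e _).injective.eq_iff
    (b := φ ∘ₗ ((tensorComplex P A).pOpcycles (j + 1)).hom)).trans ?_
  rw [ModuleCat.hom_comp, ← LinearMap.comp_assoc]
  exact LinearMap.cancel_right (pOpcycles_surjective _ _)

end Resolution

/-- Duality between `Ext(M, Hom(A, W))` and `Tor(M, A)`, when `A` and the first few modules
`Tor_j(M, A)` are acyclic for `Hom(-, W)`. -/
theorem ext_tor_duality {R : Type u} [CommRing R] {M N A W : Type u} [AddCommGroup M] [Module R M]
    [AddCommGroup N] [Module R N] [AddCommGroup A] [Module R A] [AddCommGroup W] [Module R W]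
    (e : N ≃ₗ[R] (A →ₗ[R] W)) (hA : IsHomAcyclic R W A) {n : ℕ} (hn : 1 ≤ n)
    (hT : ∀ j < n, IsHomAcyclic R W (TorMod R M A j)) :
    (∀ j ≤ n, Nonempty (ExtMod R M N j ≃ₗ[R] (TorMod R M A j →ₗ[R] W))) ∧
    ∃ (f₁ : ExtMod R (TorMod R M A n) W 1 →ₗ[R] ExtMod R M N (n + 1))
      (f₂ : ExtMod R M N (n + 1) →ₗ[R] (TorMod R M A (n + 1) →ₗ[R] W))
      (f₃ : (TorMod R M A (n + 1) →ₗ[R] W) →ₗ[R] ExtMod R (TorMod R M A n) W 2)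
      (f₄ : ExtMod R (TorMod R M A n) W 2 →ₗ[R] ExtMod R M N (n + 2)),
      Function.Injective f₁ ∧ Function.Exact f₁ f₂ ∧ Function.Exact f₂ f₃ ∧
        Function.Exact f₃ f₄ := by
  let P := projectiveResolution (ModuleCat.of R M)
  let K := tensorComplex P A
  have eT : TorMod R M A 0 ≃ₗ[R] K.opcycles 0 :=
    torEquiv P A 0 ≪≫ₗ (ChainComplex.isoHomologyι₀ K).toLinearEquiv
  refine duality_of_acyclic (W := W) (C := fun j ↦ K.X j) (D := fun j ↦ K.opcycles j)
    (T := fun j ↦ TorMod R M A j) (E := fun j ↦ ExtMod R M N j)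
    (τ := fun j ↦ (K.homologyι (j + 1)).hom ∘ₗ (torEquiv P A (j + 1)).toLinearMap)
    (ι := fun j ↦ (K.fromOpcycles (j + 1) j).hom) (p := fun j ↦ (K.pOpcycles j).hom)
    (π := fun j ↦ extOfCocycle N P (j + 1) ∘ₗ opcyclesToCocycle P e (j + 1))
    (fun j ↦ (homologyι_injective K _).comp (torEquiv P A (j + 1)).injective)
    (fun j ↦ ?_) (fun j ↦ exact_fromOpcycles_pOpcycles K j) (fun j ↦ pOpcycles_surjective K j)
    (fun j ↦ (extOfCocycle_surjective N P _).comp (opcyclesToCocycle_surjective P e _))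
    (fun j φ ↦ extOfCocycle_opcyclesToCocycle_eq_zero_iff P e j φ) eT
    (isHomAcyclic_tensorComplex P hA) ?_ hn hT
  · intro x
    rw [exact_homologyι_fromOpcycles K j x]
    exact (torEquiv P A (j + 1)).surjective.exists
  · exact extZero M N ≪≫ₗ (curryEquiv e M).symm ≪≫ₗ
      LinearEquiv.congrLeft W R ((torZeroEquiv M A).symm ≪≫ₗ eT)

end CanonicalDuality

end

/-! ### `Ext` modulo regular elements, and Bass' bound -/

noncomputable section

namespace CanonicalDuality

open Abelian RingTheory.Sequence IsLocalRing Pointwise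

section Quotient

variable {R : Type u} [CommRing R] (W : Type u) [AddCommGroup W] [Module R W]
  {X : Type u} [AddCommGroup X] [Module R X]

lemma extMap_lsmul (r : R) (k : ℕ) (x : ExtMod R X W k) :
    extMap W (LinearMap.lsmul R X r) k x = r • x := by
  have : LinearMap.lsmul R X r = r • LinearMap.id := rfl
  rw [this, extMap_smul, extMap_id, LinearMap.smul_apply, LinearMap.id_apply]

lemma subsingleton_extMod [Subsingleton X] (k : ℕ) : Subsingleton (ExtMod R X W k) := by
  refine subsingleton_of_forall_eq 0 fun x ↦ ?_
  have h : (LinearMap.id : X →ₗ[R] X) = 0 := Subsingleton.elim _ _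
  have h' := extMap_id (X := X) (R := R) W k
  rw [h, extMap_zero] at h'
  exact (LinearMap.congr_fun h' x).symm

lemma subsingleton_extMod_congr {Y : Type u} [AddCommGroup Y] [Module R Y] (e : X ≃ₗ[R] Y) {k : ℕ}
    (h : Subsingleton (ExtMod R X W k)) : Subsingleton (ExtMod R Y W k) :=
  (extCongr W e k).symm.toEquiv.subsingleton

/-- The connecting map `Ext^k(X, W) → Ext^(k+1)(X / rX, W)` for an `X`-regular element `r`. -/
def extQuotConn {r : R} (hr : IsSMulRegular X r) (k : ℕ) :
    ExtMod R X W k →ₗ[R] ExtMod R (QuotSMulTop r X) W (k + 1) :=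
  extConn W (f := LinearMap.lsmul R X r) hr (LinearMap.exact_lsmul_mkQ_smul_top X r)
    (Submodule.mkQ_surjective _) k

variable {W} {r : R} (hr : IsSMulRegular X r)

lemma extQuotConn_eq_zero_iff {k : ℕ} (x : ExtMod R X W k) :
    extQuotConn W hr k x = 0 ↔ ∃ y, r • y = x := by
  refine (extMap_extConn_exact W (f := LinearMap.lsmul R X r) hr
    (LinearMap.exact_lsmul_mkQ_smul_top X r) (Submodule.mkQ_surjective _) k x).trans ?_
  simp only [Set.mem_range, extMap_lsmul]

lemma extQuotConn_surjective {k : ℕ} (h : Subsingleton (ExtMod R X W (k + 1))) :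
    Function.Surjective (extQuotConn W hr k) :=
  extConn_surjective W _ _ _ h

include hr in
lemma subsingleton_ext_quotSMulTop {k : ℕ} (h : Subsingleton (ExtMod R X W k))
    (h' : Subsingleton (ExtMod R X W (k + 1))) :
    Subsingleton (ExtMod R (QuotSMulTop r X) W (k + 1)) :=
  (extQuotConn_surjective hr h').subsingleton

-- The kernel of `r` on `Ext^k(X, W)` is the image of `Ext^k(X / rX, W)`.
include hr in
lemma isSMulRegular_ext {k : ℕ} (h : Subsingleton (ExtMod R (QuotSMulTop r X) W k)) :
    IsSMulRegular (ExtMod R X W k) r := by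
  refine (isSMulRegular_iff_right_eq_zero_of_smul).mpr fun x hx ↦ ?_
  rw [← extMap_lsmul] at hx
  obtain ⟨y, rfl⟩ := (extMap_exact W (f := LinearMap.lsmul R X r) hr
    (LinearMap.exact_lsmul_mkQ_smul_top X r) (Submodule.mkQ_surjective _) k x).mp hx
  rw [Subsingleton.elim y 0, map_zero]

/-- If `r` is regular on `X` and `Ext^(k+1)(X, W) = 0`, then
`Ext^k(X, W) / r Ext^k(X, W) = Ext^(k+1)(X / rX, W)`. -/
def quotSMulTopExtEquiv {k : ℕ} (h : Subsingleton (ExtMod R X W (k + 1))) :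
    QuotSMulTop r (ExtMod R X W k) ≃ₗ[R] ExtMod R (QuotSMulTop r X) W (k + 1) :=
  Submodule.quotEquivOfEq _ _ (by
    ext x
    rw [LinearMap.mem_ker, extQuotConn_eq_zero_iff, Submodule.mem_smul_pointwise_iff_exists]
    simp) ≪≫ₗ (extQuotConn W hr k).quotKerEquivOfSurjective (extQuotConn_surjective hr h)

lemma extQuotConn_naturality {Y : Type u} [AddCommGroup Y] [Module R Y] (hr' : IsSMulRegular Y r)
    (f : X →ₗ[R] Y) (k : ℕ) (y : ExtMod R Y W k) :
    extQuotConn W hr k (extMap W f k y) =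
      extMap W (QuotSMulTop.map r f) (k + 1) (extQuotConn W hr' k y) := by
  refine extConn_naturality W _ _ _ _ _ _ (b := f) ?_ ?_ k y
  · ext x; simp
  · ext x; rfl

end Quotient

section Sequence

variable {R : Type u} [CommRing R]

/-- Retracts survive division by `r`. This lets a sequence regular on a product be used on each
factor. -/
lemma IsWeaklyRegular.of_retract {X Z : Type*} [AddCommGroup X] [Module R X] [AddCommGroup Z]
    [Module R Z] {rs : List R} (i : X →ₗ[R] Z) (p : Z →ₗ[R] X) (h : p ∘ₗ i = LinearMap.id)
    (hZ : IsWeaklyRegular Z rs) : IsWeaklyRegular X rs := by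
  induction rs generalizing X Z with
  | nil => exact IsWeaklyRegular.nil R X
  | cons r rs ih =>
    rw [isWeaklyRegular_cons_iff] at hZ ⊢
    refine ⟨hZ.1.of_injective i (Function.LeftInverse.injective (LinearMap.congr_fun h)), ?_⟩
    exact ih (QuotSMulTop.map r i) (QuotSMulTop.map r p)
      (by rw [← QuotSMulTop.map_comp, h, QuotSMulTop.map_id]) hZ.2

/-- Quotients by the submodules generated by a sequence, for isomorphic modules. -/
def quotOfListEquiv {X Y : Type*} [AddCommGroup X] [Module R X] [AddCommGroup Y] [Module R Y]
    (rs : List R) (e : X ≃ₗ[R] Y) : (X ⧸ (Ideal.ofList rs • ⊤ : Submodule R X)) ≃ₗ[R]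
      (Y ⧸ (Ideal.ofList rs • ⊤ : Submodule R Y)) :=
  Submodule.Quotient.equiv _ _ e (by
    rw [Submodule.map_smul'', Submodule.map_top]
    exact congr_arg _ (LinearMap.range_eq_top.mpr e.surjective))

lemma surjective_of_injective_of_length_eq {X Y : Type*} [AddCommGroup X] [Module R X]
    [AddCommGroup Y] [Module R Y] {f : X →ₗ[R] Y} (hf : Function.Injective f)
    (h : Module.length R X = Module.length R Y) (hX : IsFiniteLength R X) :
    Function.Surjective f := by
  rw [← Module.length_ne_top_iff] at hX
  have := Module.length_eq_add_of_exact f (LinearMap.range f).mkQ hf (Submodule.mkQ_surjective _)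
    (LinearMap.exact_map_mkQ_range f)
  rw [← h] at this
  have h0 : Module.length R (Y ⧸ LinearMap.range f) = 0 := by
    refine ((ENat.addLECancellable_of_ne_top hX).inj.mp ?_).symm
    rwa [add_zero]
  rwa [Module.length_eq_zero_iff, Submodule.Quotient.subsingleton_iff,
    LinearMap.range_eq_top] at h0

lemma injective_of_surjective_of_length_eq {X Y : Type*} [AddCommGroup X] [Module R X]
    [AddCommGroup Y] [Module R Y] {f : X →ₗ[R] Y} (hf : Function.Surjective f)
    (h : Module.length R X = Module.length R Y) (hX : IsFiniteLength R X) :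
    Function.Injective f := by
  rw [← Module.length_ne_top_iff] at hX
  have := Module.length_eq_add_of_exact (LinearMap.ker f).subtype f
    (Submodule.injective_subtype _) hf (exact_ker_subtype f)
  rw [← h] at this
  have h0 : Module.length R (LinearMap.ker f) = 0 := by
    refine ((ENat.addLECancellable_of_ne_top hX).inj.mp ?_).symm
    rwa [add_zero, add_comm]
  rwa [Module.length_eq_zero_iff, Submodule.subsingleton_iff_eq_bot, LinearMap.ker_eq_bot] at h0

end Sequence

section Local

variable {R : Type u} [CommRing R] [IsLocalRing R]

lemma span_singleton_le_jacobson {r : R} (hr : r ∈ maximalIdeal R) :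
    Ideal.span {r} ≤ (⊥ : Ideal R).jacobson :=
  (jacobson_eq_maximalIdeal (⊥ : Ideal R) bot_ne_top).symm ▸
    (Ideal.span_singleton_le_iff_mem _).mpr hr

lemma ofList_le_jacobson {rs : List R} (hrs : ∀ r ∈ rs, r ∈ maximalIdeal R) :
    Ideal.ofList rs ≤ (⊥ : Ideal R).jacobson :=
  (jacobson_eq_maximalIdeal (⊥ : Ideal R) bot_ne_top).symm ▸ Ideal.span_le.mpr hrs

omit [IsLocalRing R] in
lemma surjective_of_surjective_mapQ {I : Ideal R} (hI : I ≤ (⊥ : Ideal R).jacobson)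
    {X Y : Type*} [AddCommGroup X] [Module R X] [AddCommGroup Y] [Module R Y] [Module.Finite R Y]
    (f : X →ₗ[R] Y)
    (h : ∀ y, ∃ x, y - f x ∈ (I • ⊤ : Submodule R Y)) : Function.Surjective f := by
  rw [← LinearMap.range_eq_top, eq_top_iff]
  refine Submodule.le_of_le_smul_of_le_jacobson_bot Module.Finite.fg_top hI fun y _ ↦ ?_
  obtain ⟨x, hx⟩ := h y
  rw [← sub_add_cancel y (f x), add_comm]
  exact Submodule.add_mem_sup ⟨x, rfl⟩ hx

lemma subsingleton_of_smul_surjective {X : Type*} [AddCommGroup X] [Module R X]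
    [Module.Finite R X] {r : R} (hr : r ∈ maximalIdeal R) (h : ∀ x : X, ∃ y, r • y = x) :
    Subsingleton X := by
  rw [← Submodule.subsingleton_iff R, ← subsingleton_iff_bot_eq_top, eq_comm]
  refine Submodule.eq_bot_of_le_smul_of_le_jacobson_bot (Ideal.span {r}) _ Module.Finite.fg_top
    (fun x _ ↦ ?_) (span_singleton_le_jacobson hr)
  obtain ⟨y, rfl⟩ := h x
  exact Submodule.smul_mem_smul (Ideal.mem_span_singleton_self r) trivial

variable [IsNoetherianRing R] {W : Type u} [AddCommGroup W] [Module R W] [Module.Finite R W]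

/-- The connecting map vanishes, so `Ext^k(X, W)` equals `r` times itself; it is finite, and
Nakayama applies. -/
lemma subsingleton_ext_of_quotSMulTop {X : Type u} [AddCommGroup X] [Module R X]
    [Module.Finite R X] {r : R} (hr : IsSMulRegular X r) (hm : r ∈ maximalIdeal R) {k : ℕ}
    (h : Subsingleton (ExtMod R (QuotSMulTop r X) W (k + 1))) :
    Subsingleton (ExtMod R X W k) := by
  have : Module.Finite R (ExtMod R X W k) := ModuleCat.finite_ext R _ _ k
  refine subsingleton_of_smul_surjective hm fun x ↦ ?_
  rw [← extQuotConn_eq_zero_iff hr]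
  exact Subsingleton.elim _ _

lemma subsingleton_ext_of_isWeaklyRegular {d : ℕ}
    (hd : ∀ (Y : Type u) [AddCommGroup Y] [Module R Y] [Module.Finite R Y], ∀ i > d,
      Subsingleton (ExtMod R Y W i))
    {rs : List R} (hm : ∀ r ∈ rs, r ∈ maximalIdeal R)
    {X : Type u} [AddCommGroup X] [Module R X] [Module.Finite R X]
    (hX : IsWeaklyRegular X rs) {i : ℕ} (hi : d < i + rs.length) :
    Subsingleton (ExtMod R X W i) := by
  induction rs generalizing X i with
  | nil => exact hd X i hi
  | cons r rs ih =>
    rw [isWeaklyRegular_cons_iff] at hX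
    rw [List.forall_mem_cons] at hm
    refine subsingleton_ext_of_quotSMulTop hX.1 hm.1 (ih hm.2 hX.2 ?_)
    rw [List.length_cons] at hi
    lia

omit [IsLocalRing R] [IsNoetherianRing R] [Module.Finite R W] in
lemma subsingleton_ext_quot_ofList {rs : List R} {X : Type u} [AddCommGroup X] [Module R X]
    (hX : IsWeaklyRegular X rs) {k : ℕ} (hk : ∀ i > k, Subsingleton (ExtMod R X W i)) {i : ℕ}
    (hi : k + rs.length < i) :
    Subsingleton (ExtMod R (X ⧸ (Ideal.ofList rs • ⊤ : Submodule R X)) W i) := by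
  induction rs generalizing X k with
  | nil =>
    refine subsingleton_extMod_congr W (Submodule.quotEquivOfEqBot _ ?_).symm (hk i (by simpa))
    simp
  | cons r rs ih =>
    rw [isWeaklyRegular_cons_iff] at hX
    rw [List.length_cons] at hi
    refine subsingleton_extMod_congr W
      (Submodule.quotOfListConsSMulTopEquivQuotSMulTopInner X r rs).symm
      (ih hX.2 (k := k + 1) (fun j hj ↦ ?_) (by lia))
    obtain ⟨j, rfl⟩ : ∃ j', j = j' + 1 := ⟨j - 1, by lia⟩
    exact subsingleton_ext_quotSMulTop hX.1 (hk j (by lia)) (hk _ (by lia))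

instance : IsSimpleModule R (ResidueField R) :=
  isSimpleModule_iff_quot_maximal.mpr ⟨maximalIdeal R, inferInstance, ⟨.refl R _⟩⟩

/-- The residue field embeds into the quotient of `R` by a maximal regular sequence. -/
lemma exists_residueField_injective {rs : List R}
    (hR : IsWeaklyRegular R rs) (hmax : ∀ r ∈ maximalIdeal R, ¬ IsWeaklyRegular R (rs ++ [r])) :
    ∃ f : ResidueField R →ₗ[R] (R ⧸ (Ideal.ofList rs • ⊤ : Submodule R R)),
      Function.Injective f := by
  by_contra! hf
  have hsub : Subsingleton (ResidueField R →ₗ[R] (R ⧸ (Ideal.ofList rs • ⊤ : Submodule R R))) :=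
    subsingleton_of_forall_eq 0 fun f ↦ f.injective_or_eq_zero.resolve_left (hf f)
  -- If no nonzero map from the residue field exists, some element of its annihilator is regular on
  -- the quotient and prolongs `rs`.
  obtain ⟨r, hr, hreg⟩ := IsSMulRegular.subsingleton_linearMap_iff.mp hsub
  refine hmax r ?_ ((isWeaklyRegular_append_iff R rs [r]).mpr
    ⟨hR, (isWeaklyRegular_singleton_iff _ _).mpr hreg⟩)
  have : Module.annihilator R (R ⧸ maximalIdeal R) = maximalIdeal R := Ideal.annihilator_quotient
  rw [← this]
  exact hr

/-- Bass' bound: a finite module of finite injective dimension over a Noetherian local ring has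
injective dimension at most the length of a maximal regular sequence. -/
theorem subsingleton_ext_of_finite_injectiveDimension {b : ℕ}
    (hb : HasInjectiveDimensionLE (ModuleCat.of R W) b) {rs : List R}
    (hR : IsWeaklyRegular R rs) (hmax : ∀ r ∈ maximalIdeal R, ¬ IsWeaklyRegular R (rs ++ [r]))
    (X : Type u) [AddCommGroup X] [Module R X] [Module.Finite R X] (i : ℕ) (hi : rs.length < i) :
    Subsingleton (ExtMod R X W i) := by
  obtain ⟨f, hf⟩ := exists_residueField_injective hR hmax
  -- Descending step: vanishing in degree `c + 1` on all finite modules gives it in degree `c`, as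
  -- long as `c > rs.length`.
  have key (c : ℕ) (hc : c > rs.length)
      (h : ∀ (Y : Type u) [AddCommGroup Y] [Module R Y] [Module.Finite R Y],
        Subsingleton (ExtMod R Y W (c + 1)))
      (Y : Type u) [AddCommGroup Y] [Module R Y] [Module.Finite R Y] :
      Subsingleton (ExtMod R Y W c) := by
    -- The residue field embeds in `R / (rs)`, whose `Ext^c` vanishes, and `Ext^(c+1)` of the
    -- cokernel vanishes too.
    have hk : Subsingleton (ExtMod R (ResidueField R) W c) := by
      refine subsingleton_ext_left W hf (LinearMap.exact_map_mkQ_range f)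
        (Submodule.mkQ_surjective _) ?_ (h _)
      refine subsingleton_ext_quot_ofList hR (k := 0) (fun j hj ↦ ?_) (by lia)
      obtain ⟨j, rfl⟩ : ∃ j', j = j' + 1 := ⟨j - 1, by lia⟩
      exact subsingleton_extMod_of_projective W j
    induction ‹Module.Finite R Y› using
      IsNoetherianRing.induction_on_isQuotientEquivQuotientPrime R with
    | subsingleton N => exact subsingleton_extMod W c
    | quotient N p e =>
      refine subsingleton_extMod_congr W e.symm ?_
      by_cases hp : p.asIdeal = maximalIdeal R
      · exact subsingleton_extMod_congr W (Submodule.quotEquivOfEq _ _ hp.symm) hk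
      -- For a non-maximal prime, an element of the maximal ideal outside it is regular on `R / p`,
      -- and degree `c + 1` controls degree `c`.
      · obtain ⟨x, hx, hxp⟩ := SetLike.exists_of_lt
          ((le_maximalIdeal p.isPrime.ne_top).lt_of_ne hp)
        refine subsingleton_ext_of_quotSMulTop (r := x) ?_ hx (h _)
        refine (isSMulRegular_iff_right_eq_zero_of_smul).mpr fun y hy ↦ ?_
        obtain ⟨y, rfl⟩ := Ideal.Quotient.mk_surjective y
        rw [Algebra.smul_def, Ideal.Quotient.algebraMap_eq, ← map_mul,
          Ideal.Quotient.eq_zero_iff_mem] at hy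
        exact Ideal.Quotient.eq_zero_iff_mem.mpr ((p.isPrime.mem_or_mem hy).resolve_left hxp)
    | exact N₁ N₂ N₃ f g hf hg hfg h₁ h₃ => exact subsingleton_ext_middle W hf hfg hg h₁ h₃
  have main (m : ℕ) : ∀ c, b < c + m → rs.length < c → ∀ (Y : Type u) [AddCommGroup Y]
      [Module R Y] [Module.Finite R Y], Subsingleton (ExtMod R Y W c) := by
    induction m with
    | zero =>
      intro c hc _ Y _ _ _
      exact HasInjectiveDimensionLT.subsingleton (ModuleCat.of R W) (b + 1) c (by lia) _
    | succ m ih =>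
      intro c hc hc' Y _ _ _
      exact key c hc' (ih (c + 1) (by lia) (by lia)) Y
  exact main (b + 1) i (by lia) hi X

end Local

end CanonicalDuality

end

/-! ### Depth and common regular sequences -/

noncomputable section

namespace CanonicalDuality

open Abelian RingTheory.Sequence IsLocalRing Pointwise

section Depth

variable {R : Type u} [CommRing R] [IsLocalRing R]

lemma length_le_depth {M : Type u} [AddCommGroup M] [Module R M] {rs : List R}
    (hm : ∀ r ∈ rs, r ∈ maximalIdeal R) (hrs : IsWeaklyRegular M rs) :
    (rs.length : ℕ∞) ≤ depth R M :=
  le_iSup₂_of_le rs hm (le_iSup_of_le hrs le_rfl)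

lemma exists_isWeaklyRegular_of_depth_eq {M : Type u} [AddCommGroup M] [Module R M] {d : ℕ}
    (h : depth R M = d) :
    ∃ rs : List R, rs.length = d ∧ (∀ r ∈ rs, r ∈ maximalIdeal R) ∧ IsWeaklyRegular M rs := by
  by_contra! hne
  have hlt (rs : List R) (hm : ∀ r ∈ rs, r ∈ maximalIdeal R) (hrs : IsWeaklyRegular M rs) :
      rs.length < d := by
    have := length_le_depth hm hrs
    rw [h, Nat.cast_le] at this
    exact this.lt_of_ne fun he ↦ hne rs he hm hrs
  -- The empty sequence rules out `d = 0`, where the truncated `d - 1` would give no contradiction.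
  have hd : 0 < d := hlt [] (by simp) (.nil R M)
  have : depth R M ≤ (d - 1 : ℕ) := iSup₂_le fun rs hm ↦ iSup_le fun hrs ↦
    Nat.cast_le.mpr (Nat.le_sub_one_of_lt (hlt rs hm hrs))
  rw [h, Nat.cast_le] at this
  lia

variable [IsNoetherianRing R]

omit [IsNoetherianRing R] in
lemma smul_top_lt_top (M : Type*) [AddCommGroup M] [Module R M] [Module.Finite R M]
    [Nontrivial M] : maximalIdeal R • (⊤ : Submodule R M) < ⊤ :=
  (Submodule.top_ne_ideal_smul_of_le_jacobson_annihilator (maximalIdeal_le_jacobson _)).symm.lt_top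

omit [IsLocalRing R] [IsNoetherianRing R] in
lemma subsingleton_ext_of_subsingleton_right {X M : Type u} [AddCommGroup X] [Module R X]
    [AddCommGroup M] [Module R M] [Subsingleton M] (i : ℕ) : Subsingleton (ExtMod R X M i) := by
  refine subsingleton_of_forall_eq 0 fun x ↦ ?_
  have : ModuleCat.ofHom (LinearMap.id : M →ₗ[R] M) = 0 :=
    ModuleCat.hom_ext (Subsingleton.elim _ _)
  rw [← Ext.comp_mk₀_id x]
  refine (congr_arg (fun f ↦ Ext.comp x (Ext.mk₀ f) (add_zero i)) this).trans ?_
  simp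

lemma subsingleton_ext_residueField {M : Type u} [AddCommGroup M] [Module R M] [Module.Finite R M]
    {rs : List R} (hm : ∀ r ∈ rs, r ∈ maximalIdeal R) (hrs : IsWeaklyRegular M rs) (i : ℕ)
    (hi : i < rs.length) : Subsingleton (ExtMod R (ResidueField R) M i) := by
  cases subsingleton_or_nontrivial M
  · exact subsingleton_ext_of_subsingleton_right i
  · refine ModuleCat.subsingleton_ext_of_exists_isRegular (maximalIdeal R)
      (ModuleCat.of R (ResidueField R)) ?_ (ModuleCat.of R M) (smul_top_lt_top M) rs hm
      (.of_isWeaklyRegular_of_mem_maximalIdeal M hm hrs) i hi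
    rw [Module.support_eq_zeroLocus]
    exact PrimeSpectrum.zeroLocus_anti_mono (Ideal.annihilator_quotient (I := maximalIdeal R)).ge

/-- Rees' vanishing for the ideal generated by `rs`, which contains the support of `Z` in its zero
locus. -/
lemma subsingleton_ext_of_smul_eq_zero {M Z : Type u} [AddCommGroup M] [Module R M]
    [Module.Finite R M] [Nontrivial M] [AddCommGroup Z] [Module R Z] [Module.Finite R Z]
    {rs : List R} (hm : ∀ r ∈ rs, r ∈ maximalIdeal R) (hrs : IsWeaklyRegular M rs)
    (hZ : ∀ r ∈ rs, ∀ z : Z, r • z = 0) (i : ℕ) (hi : i < rs.length) :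
    Subsingleton (ExtMod R Z M i) := by
  have hreg : IsRegular M rs := .of_isWeaklyRegular_of_mem_maximalIdeal M hm hrs
  refine ModuleCat.subsingleton_ext_of_exists_isRegular (Ideal.ofList rs)
    (ModuleCat.of R Z) ?_ (ModuleCat.of R M) hreg.top_ne_smul.symm.lt_top rs
    (fun r hr ↦ Ideal.subset_span hr) hreg i hi
  rw [Module.support_eq_zeroLocus]
  refine PrimeSpectrum.zeroLocus_anti_mono (Ideal.span_le.mpr fun r hr ↦ ?_)
  exact Module.mem_annihilator.mpr (hZ r hr)

omit [IsLocalRing R] [IsNoetherianRing R] in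
lemma subsingleton_ext_prod {k X Y : Type u} [AddCommGroup k] [Module R k] [AddCommGroup X]
    [Module R X] [AddCommGroup Y] [Module R Y] {i : ℕ} (hX : Subsingleton (ExtMod R k X i))
    (hY : Subsingleton (ExtMod R k Y i)) : Subsingleton (ExtMod R k (X × Y) i) := by
  refine subsingleton_of_forall_eq 0 fun x ↦ ?_
  obtain ⟨y, rfl⟩ := Ext.covariant_sequence_exact₂ (ModuleCat.of R k)
    (shortExact_of_exact (LinearMap.inl_injective (R := R) (M := X) (M₂ := Y))
      Function.Exact.inl_snd Prod.snd_surjective) x (hY.elim _ _)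
  rw [hX.elim y 0]
  simp

/-- Finite modules which have weakly regular sequences of length `d` have a common one. -/
lemma exists_common_isWeaklyRegular {X Y : Type u} [AddCommGroup X] [Module R X]
    [Module.Finite R X] [AddCommGroup Y] [Module R Y] [Module.Finite R Y] [Nontrivial Y] {d : ℕ}
    (hX : ∃ rs : List R, rs.length = d ∧ (∀ r ∈ rs, r ∈ maximalIdeal R) ∧ IsWeaklyRegular X rs)
    (hY : ∃ rs : List R, rs.length = d ∧ (∀ r ∈ rs, r ∈ maximalIdeal R) ∧ IsWeaklyRegular Y rs) :
    ∃ rs : List R, rs.length = d ∧ (∀ r ∈ rs, r ∈ maximalIdeal R) ∧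
      IsWeaklyRegular (X × Y) rs := by
  obtain ⟨xs, rfl, hxm, hxr⟩ := hX
  obtain ⟨ys, hl, hym, hyr⟩ := hY
  -- Vanishing of `Ext^i(k, -)` for `i < d`, with `k` the residue field, passes to the product and
  -- yields a regular sequence on it.
  obtain ⟨rs, hrl, hrm, hrr⟩ := ModuleCat.exists_isRegular_of_exists_subsingleton_ext
    (maximalIdeal R) xs.length (ModuleCat.of R (X × Y)) (smul_top_lt_top (X × Y))
    (ModuleCat.of R (ResidueField R)) (by
      rw [Module.support_eq_zeroLocus]
      exact congr_arg _ (congr_arg _ (Ideal.annihilator_quotient (I := maximalIdeal R))))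
    (fun i hi ↦ subsingleton_ext_prod (subsingleton_ext_residueField hxm hxr i hi)
      (subsingleton_ext_residueField hym hyr i (hl ▸ hi)))
  exact ⟨rs, hrl, hrm, hrr.toIsWeaklyRegular⟩

omit [IsLocalRing R] [IsNoetherianRing R] in
lemma IsWeaklyRegular.fst {X Y : Type*} [AddCommGroup X] [Module R X] [AddCommGroup Y] [Module R Y]
    {rs : List R} (h : IsWeaklyRegular (X × Y) rs) : IsWeaklyRegular X rs :=
  IsWeaklyRegular.of_retract (LinearMap.inl R X Y) (LinearMap.fst R X Y) (by ext; rfl) h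

omit [IsLocalRing R] [IsNoetherianRing R] in
lemma IsWeaklyRegular.snd {X Y : Type*} [AddCommGroup X] [Module R X] [AddCommGroup Y] [Module R Y]
    {rs : List R} (h : IsWeaklyRegular (X × Y) rs) : IsWeaklyRegular Y rs :=
  IsWeaklyRegular.of_retract (LinearMap.inr R X Y) (LinearMap.snd R X Y) (by ext; rfl) h

/-- A finite module killed by an `R`-regular sequence of length `dim R` has finite length. -/
lemma isFiniteLength_of_smul_eq_zero {rs : List R} (hm : ∀ r ∈ rs, r ∈ maximalIdeal R)
    (hrs : IsWeaklyRegular R rs) (hd : ringKrullDim R = rs.length)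
    {Z : Type u} [AddCommGroup Z] [Module R Z] [Module.Finite R Z]
    (hZ : ∀ r ∈ rs, ∀ z : Z, r • z = 0) : IsFiniteLength R Z := by
  have hreg : IsRegular R rs := .of_isWeaklyRegular_of_mem_maximalIdeal R hm hrs
  have hdim := ringKrullDim_add_length_eq_ringKrullDim_of_isRegular rs hreg
  -- The quotient has dimension 0, so every prime containing `rs` is maximal and every prime factor
  -- `R / p` of `Z` is simple.
  have hle : Ring.KrullDimLE 0 (R ⧸ Ideal.ofList rs) := by
    rw [Ring.krullDimLE_iff]
    rw [hd] at hdim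
    have h0 : ringKrullDim (R ⧸ Ideal.ofList rs) + (rs.length : WithBot ℕ∞) =
      0 + (rs.length : WithBot ℕ∞) := by rw [hdim, zero_add]
    exact (ENat.WithBot.add_natCast_cancel.mp h0).le
  induction ‹Module.Finite R Z› using
      IsNoetherianRing.induction_on_isQuotientEquivQuotientPrime R with
  | subsingleton N => exact .of_subsingleton
  | quotient N p e =>
    have hle' : Ideal.ofList rs ≤ p.asIdeal := Ideal.span_le.mpr fun r hr ↦ by
      have := hZ r hr (e.symm 1)
      rw [← map_smul, LinearEquiv.map_eq_zero_iff, Algebra.smul_def, mul_one] at this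
      exact Ideal.Quotient.eq_zero_iff_mem.mp this
    have hpm : p.asIdeal.IsMaximal := by
      have hmin := (Ideal.krullDimLE_zero_quotient_iff_forall_minimalPrimes_isMaximal
        (I := Ideal.ofList rs)).mp hle
      obtain ⟨q, hq, hqp⟩ := Ideal.exists_minimalPrimes_le hle'
      exact (hmin q hq).eq_of_le p.isPrime.ne_top hqp ▸ hmin q hq
    have : IsSimpleModule R N := isSimpleModule_iff_quot_maximal.mpr ⟨_, hpm, ⟨e⟩⟩
    rw [← Module.length_ne_top_iff, Module.length_eq_one]
    simp
  | exact N₁ N₂ N₃ f g hf hg hfg h₁ h₃ =>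
    have h₁ := h₁ fun r hr z ↦ hf (by rw [map_smul, hZ r hr, map_zero])
    have h₃ := h₃ fun r hr z ↦ by
      obtain ⟨z, rfl⟩ := hg z
      rw [← map_smul, hZ r hr, map_zero]
    rw [← Module.length_ne_top_iff] at h₁ h₃ ⊢
    rw [Module.length_eq_add_of_exact f g hf hg hfg]
    exact WithTop.add_ne_top.mpr ⟨h₁, h₃⟩

end Depth

end CanonicalDuality

end

/-! ### Length and detection of isomorphisms by a dualizing module -/

noncomputable section

namespace CanonicalDuality

open Abelian RingTheory.Sequence IsLocalRing Pointwise

variable {R : Type u} [CommRing R] [IsLocalRing R]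

/-- Nakayama twice. For injectivity, `ker f = r • ker f`: an element of the kernel is some `r • z`,
and regularity on `Y` puts `z` in the kernel. -/
lemma bijective_of_bijective_quotSMulTop [IsNoetherianRing R] {X Y : Type u} [AddCommGroup X]
    [Module R X]
    [Module.Finite R X] [AddCommGroup Y] [Module R Y] [Module.Finite R Y] {r : R}
    (hr : r ∈ maximalIdeal R) (hY : IsSMulRegular Y r) {f : X →ₗ[R] Y}
    (hf : Function.Bijective (QuotSMulTop.map r f)) : Function.Bijective f := by
  constructor
  · rw [← LinearMap.ker_eq_bot]
    refine Submodule.eq_bot_of_le_smul_of_le_jacobson_bot (Ideal.span {r}) _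
      (IsNoetherian.noetherian _) (fun x hx ↦ ?_) (span_singleton_le_jacobson hr)
    have hx0 : (Submodule.Quotient.mk x : QuotSMulTop r X) = 0 := hf.1 (by
      rw [QuotSMulTop.map_apply_mk, LinearMap.mem_ker.mp hx, map_zero]; rfl)
    obtain ⟨z, -, rfl⟩ := (Submodule.Quotient.mk_eq_zero _).mp hx0
    refine Submodule.smul_mem_smul (Ideal.mem_span_singleton_self r) (LinearMap.mem_ker.mpr ?_)
    refine hY.right_eq_zero_of_smul ?_
    rw [← map_smul]
    exact hx
  · refine surjective_of_surjective_mapQ (span_singleton_le_jacobson hr) f fun y ↦ ?_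
    obtain ⟨x, hx⟩ := hf.2 (Submodule.Quotient.mk y)
    obtain ⟨x, rfl⟩ := Submodule.mkQ_surjective _ x
    refine ⟨x, ?_⟩
    rw [Submodule.ideal_span_singleton_smul, ← Submodule.Quotient.eq]
    exact hx.symm

/-- The cohomological properties of a canonical module of a `d`-dimensional ring. -/
structure IsDualizing (W : Type u) [AddCommGroup W] [Module R W] (d : ℕ) : Prop where
  finite : Module.Finite R W
  subsingleton_ext : ∀ (Y : Type u) [AddCommGroup Y] [Module R Y] [Module.Finite R Y], ∀ i > d,
    Subsingleton (ExtMod R Y W i)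
  subsingleton_ext_residueField : ∀ i < d, Subsingleton (ExtMod R (ResidueField R) W i)
  length_ext_residueField : Module.length R (ExtMod R (ResidueField R) W d) = 1

namespace IsDualizing

variable {W : Type u} [AddCommGroup W] [Module R W] {d : ℕ} (hW : IsDualizing (R := R) W d)

include hW

lemma nontrivial : Nontrivial W := by
  by_contra h
  rw [not_nontrivial_iff_subsingleton] at h
  have := subsingleton_ext_of_subsingleton_right (R := R) (X := ResidueField R) (M := W) d
  simpa using (Module.length_eq_zero (R := R)).symm.trans hW.length_ext_residueField

/-- Dévissage to the residue field: vanishing in degrees `d - 1` and `d + 1` makes `Ext^d(-, W)`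
exact, and each simple factor contributes length 1. -/
lemma length_ext {L : Type u} [AddCommGroup L] [Module R L] (hL : IsFiniteLength R L) :
    (∀ i < d, Subsingleton (ExtMod R L W i)) ∧
      Module.length R (ExtMod R L W d) = Module.length R L := by
  induction hL with
  | of_subsingleton =>
    refine ⟨fun i _ ↦ subsingleton_extMod W i, ?_⟩
    have := subsingleton_extMod (R := R) W (X := ‹_›) d
    rw [Module.length_eq_zero, Module.length_eq_zero]
  | @of_simple_quotient L _ _ N hs hN ih =>
    obtain ⟨I, hI, ⟨e⟩⟩ := isSimpleModule_iff_quot_maximal.mp hs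
    obtain rfl := eq_maximalIdeal hI
    have e' : ResidueField R ≃ₗ[R] L ⧸ N := e.symm
    have hi := N.injective_subtype
    have hex : Function.Exact N.subtype N.mkQ := LinearMap.exact_subtype_mkQ N
    have hsu := N.mkQ_surjective
    have hlow (i) (h : i < d) : Subsingleton (ExtMod R (L ⧸ N) W i) :=
      subsingleton_extMod_congr W e' (hW.subsingleton_ext_residueField i h)
    refine ⟨fun i h ↦ subsingleton_ext_middle W hi hex hsu (ih.1 i h) (hlow i h), ?_⟩
    have hinj : Function.Injective (extMap W N.mkQ d) := by
      obtain _ | d := d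
      · exact extMap_zero_injective W hsu
      · exact extMap_succ_injective W hi hex hsu (ih.1 d (by lia))
    have hfin : Module.Finite R (L ⧸ N) := Module.Finite.equiv e'
    have hsurj := extMap_surjective W hi hex hsu (hW.subsingleton_ext (L ⧸ N) (d + 1) (by lia))
    rw [Module.length_eq_add_of_exact _ _ hinj hsurj (extMap_exact W hi hex hsu d), ih.2,
      ← (extCongr W e' d).length_eq, hW.length_ext_residueField,
      Module.length_eq_add_of_exact _ _ hi hsu hex, Module.length_eq_one R (L ⧸ N), add_comm]

lemma injective_extMap_of_surjective {X Y : Type u} [AddCommGroup X] [Module R X] [AddCommGroup Y]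
    [Module R Y] (hX : IsFiniteLength R X) {f : X →ₗ[R] Y} (hf : Function.Surjective f) :
    Function.Injective (extMap W f d) := by
  have hi := Submodule.injective_subtype (LinearMap.ker f)
  obtain _ | d := d
  · exact extMap_zero_injective W hf
  · exact extMap_succ_injective W hi (exact_ker_subtype f) hf
      ((hW.length_ext (hX.of_injective hi)).1 d (by lia))

/-- `Ext^d` of the cokernel embeds in `Ext^d(Y, W)` with zero image, so the cokernel has length 0;
equality of lengths then gives injectivity. -/
lemma bijective_of_bijective_extMap_of_isFiniteLength {X Y : Type u} [AddCommGroup X] [Module R X]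
    [AddCommGroup Y] [Module R Y] (hX : IsFiniteLength R X) (hY : IsFiniteLength R Y)
    {f : X →ₗ[R] Y} (hf : Function.Bijective (extMap W f d)) : Function.Bijective f := by
  have hsurj : Function.Surjective f := by
    have hq := (LinearMap.range f).mkQ_surjective
    have h0 : Subsingleton (ExtMod R (Y ⧸ LinearMap.range f) W d) := by
      refine subsingleton_of_forall_eq 0 fun x ↦ ?_
      refine hW.injective_extMap_of_surjective hY hq (hf.1 ?_)
      rw [← LinearMap.comp_apply, ← extMap_comp, LinearMap.range_mkQ_comp, extMap_zero, map_zero,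
        map_zero, LinearMap.zero_apply]
    have := (hW.length_ext (hY.of_surjective hq)).2
    rwa [Module.length_eq_zero, eq_comm, Module.length_eq_zero_iff,
      Submodule.Quotient.subsingleton_iff, LinearMap.range_eq_top] at this
  refine ⟨injective_of_surjective_of_length_eq hsurj ?_ hX, hsurj⟩
  rw [← (hW.length_ext hX).2, ← (hW.length_ext hY).2]
  exact (LinearEquiv.ofBijective _ hf).length_eq.symm

variable [IsNoetherianRing R]

/-- If `rs` is a weakly regular sequence on `Y`, it is one on `Ext^k(Y, W)` for the relevant `k`,
and the quotients by it have the same length. -/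
lemma isWeaklyRegular_ext_and_length_eq {rs₀ rs : List R} {k : ℕ} (hk : rs₀.length = k)
    (hm : ∀ r ∈ rs₀ ++ rs, r ∈ maximalIdeal R) (hWrs : IsWeaklyRegular W (rs₀ ++ rs))
    (hd : k + rs.length = d)
    {Y : Type u} [AddCommGroup Y] [Module R Y] [Module.Finite R Y]
    (hY₀ : ∀ r ∈ rs₀, ∀ y : Y, r • y = 0) (hY : IsWeaklyRegular Y rs)
    (hfl : IsFiniteLength R (Y ⧸ (Ideal.ofList rs • ⊤ : Submodule R Y)))
    (hup : ∀ i > k, Subsingleton (ExtMod R Y W i)) :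
    IsWeaklyRegular (ExtMod R Y W k) rs ∧
      Module.length R (ExtMod R Y W k ⧸ (Ideal.ofList rs • ⊤ : Submodule R (ExtMod R Y W k))) =
        Module.length R (Y ⧸ (Ideal.ofList rs • ⊤ : Submodule R Y)) := by
  -- `rs₀` holds the elements already divided out, so its length is the degree `k`. At `k = d` only
  -- the length formula for finite length modules is left.
  induction rs generalizing rs₀ k Y with
  | nil =>
    obtain rfl : k = d := hd
    have e (Z : Type u) [AddCommGroup Z] [Module R Z] :
        (Z ⧸ (Ideal.ofList ([] : List R) • ⊤ : Submodule R Z)) ≃ₗ[R] Z :=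
      Submodule.quotEquivOfEqBot _ (by rw [Ideal.ofList_nil, Submodule.bot_smul])
    refine ⟨.nil R _, ?_⟩
    rw [(e _).length_eq, (e _).length_eq, (hW.length_ext ((e Y).isFiniteLength hfl)).2]
  | cons r rs ih =>
    have := hW.finite
    have := hW.nontrivial
    rw [isWeaklyRegular_cons_iff] at hY ⊢
    have hk' : (rs₀ ++ [r]).length = k + 1 := by simp [hk]
    have happ : rs₀ ++ r :: rs = (rs₀ ++ [r]) ++ rs := by simp
    rw [happ] at hm hWrs
    have hkill : ∀ s ∈ rs₀ ++ [r], ∀ y : QuotSMulTop r Y, s • y = 0 := by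
      intro s hs y
      rcases List.mem_append.mp hs with hs | hs
      · obtain ⟨y, rfl⟩ := Submodule.mkQ_surjective _ y
        rw [← map_smul, hY₀ s hs, map_zero]
      · rw [List.mem_singleton.mp hs]
        exact Module.mem_annihilator.mp (QuotSMulTop.mem_annihilator Y r) y
    -- `Y / rY` is killed by a `W`-regular sequence of length `k + 1`; this vanishing makes `r`
    -- regular on `Ext^k(Y, W)`.
    have hlow : Subsingleton (ExtMod R (QuotSMulTop r Y) W k) :=
      subsingleton_ext_of_smul_eq_zero (fun s hs ↦ hm s (List.mem_append_left _ hs))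
        ((isWeaklyRegular_append_iff _ _ _).mp hWrs).1 hkill k (by lia)
    have hup' : ∀ i > k + 1, Subsingleton (ExtMod R (QuotSMulTop r Y) W i) := by
      intro i hi
      obtain ⟨i, rfl⟩ : ∃ j, i = j + 1 := ⟨i - 1, by lia⟩
      exact subsingleton_ext_quotSMulTop hY.1 (hup i (by lia)) (hup _ (by lia))
    rw [List.length_cons] at hd
    have e := Submodule.quotOfListConsSMulTopEquivQuotSMulTopInner Y r rs
    have e' := Submodule.quotOfListConsSMulTopEquivQuotSMulTopInner (ExtMod R Y W k) r rs
    have eq : QuotSMulTop r (ExtMod R Y W k) ≃ₗ[R] ExtMod R (QuotSMulTop r Y) W (k + 1) :=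
      quotSMulTopExtEquiv hY.1 (hup (k + 1) (by lia))
    obtain ⟨h₁, h₂⟩ := ih hk' hm hWrs (by lia) hkill hY.2 (e.isFiniteLength hfl) hup'
    refine ⟨⟨isSMulRegular_ext hY.1 hlow, (eq.isWeaklyRegular_congr rs).mpr h₁⟩, ?_⟩
    rw [e.length_eq, ← h₂, e'.length_eq, (quotOfListEquiv rs eq).length_eq]

/-- Dividing by `r` replaces `Ext^k(f)` by its reduction mod `r`, in degree `k + 1`. In degree `d`
the modules have finite length, and Nakayama carries bijectivity back. -/
lemma bijective_of_bijective_extMap {rs : List R} (hm : ∀ r ∈ rs, r ∈ maximalIdeal R) {k : ℕ}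
    (hd : k + rs.length = d) {X Y : Type u} [AddCommGroup X] [Module R X] [Module.Finite R X]
    [AddCommGroup Y] [Module R Y] [Module.Finite R Y]
    (hX : IsWeaklyRegular X rs) (hY : IsWeaklyRegular Y rs)
    (hXfl : IsFiniteLength R (X ⧸ (Ideal.ofList rs • ⊤ : Submodule R X)))
    (hYfl : IsFiniteLength R (Y ⧸ (Ideal.ofList rs • ⊤ : Submodule R Y)))
    (hXup : ∀ i > k, Subsingleton (ExtMod R X W i))
    (hYup : ∀ i > k, Subsingleton (ExtMod R Y W i))
    {f : X →ₗ[R] Y} (hf : Function.Bijective (extMap W f k)) : Function.Bijective f := by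
  induction rs generalizing k X Y with
  | nil =>
    obtain rfl : k = d := hd
    have e (Z : Type u) [AddCommGroup Z] [Module R Z] :
        (Z ⧸ (Ideal.ofList ([] : List R) • ⊤ : Submodule R Z)) ≃ₗ[R] Z :=
      Submodule.quotEquivOfEqBot _ (by rw [Ideal.ofList_nil, Submodule.bot_smul])
    exact hW.bijective_of_bijective_extMap_of_isFiniteLength ((e X).isFiniteLength hXfl)
      ((e Y).isFiniteLength hYfl) hf
  | cons r rs ih =>
    rw [isWeaklyRegular_cons_iff] at hX hY
    rw [List.forall_mem_cons] at hm
    rw [List.length_cons] at hd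
    have hup {Z : Type u} [AddCommGroup Z] [Module R Z] (hZ : IsSMulRegular Z r)
        (hZup : ∀ i > k, Subsingleton (ExtMod R Z W i)) :
        ∀ i > k + 1, Subsingleton (ExtMod R (QuotSMulTop r Z) W i) := by
      intro i hi
      obtain ⟨i, rfl⟩ : ∃ j, i = j + 1 := ⟨i - 1, by lia⟩
      exact subsingleton_ext_quotSMulTop hZ (hZup i (by lia)) (hZup _ (by lia))
    refine bijective_of_bijective_quotSMulTop hm.1 hY.1 (ih hm.2 (k := k + 1) (by lia) hX.2 hY.2
      ((Submodule.quotOfListConsSMulTopEquivQuotSMulTopInner X r rs).isFiniteLength hXfl)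
      ((Submodule.quotOfListConsSMulTopEquivQuotSMulTopInner Y r rs).isFiniteLength hYfl)
      (hup hX.1 hXup) (hup hY.1 hYup) ⟨(injective_iff_map_eq_zero _).mpr fun y hy ↦ ?_, fun x ↦ ?_⟩)
    · obtain ⟨y, rfl⟩ := extQuotConn_surjective hY.1 (hYup (k + 1) (by lia)) y
      rw [← extQuotConn_naturality hX.1, extQuotConn_eq_zero_iff] at hy
      obtain ⟨x, hx⟩ := hy
      obtain ⟨y', rfl⟩ := hf.2 x
      rw [← map_smul] at hx
      exact (extQuotConn_eq_zero_iff hY.1 y).mpr ⟨y', hf.1 hx⟩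
    · obtain ⟨x, rfl⟩ := extQuotConn_surjective hX.1 (hXup (k + 1) (by lia)) x
      obtain ⟨y, rfl⟩ := hf.2 x
      exact ⟨extQuotConn W hY.1 k y, (extQuotConn_naturality hX.1 hY.1 f k y).symm⟩

end IsDualizing

end CanonicalDuality

end

/-! ### Biduality for maximal Cohen-Macaulay modules -/

noncomputable section

namespace CanonicalDuality

open Abelian RingTheory.Sequence IsLocalRing Pointwise

variable {R : Type u} [CommRing R] [IsLocalRing R]

lemma isFiniteLength_quotOfList [IsNoetherianRing R] {rs : List R}
    (hm : ∀ r ∈ rs, r ∈ maximalIdeal R) (hR : IsWeaklyRegular R rs)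
    (hdim : ringKrullDim R = rs.length) (X : Type u) [AddCommGroup X] [Module R X]
    [Module.Finite R X] : IsFiniteLength R (X ⧸ (Ideal.ofList rs • ⊤ : Submodule R X)) := by
  refine isFiniteLength_of_smul_eq_zero hm hR hdim fun r hr z ↦ ?_
  obtain ⟨z, rfl⟩ := Submodule.mkQ_surjective _ z
  rw [← map_smul, ← LinearMap.mem_ker, Submodule.ker_mkQ]
  exact Submodule.smul_mem_smul (Ideal.subset_span hr) trivial

namespace IsDualizing

variable [IsNoetherianRing R] {W : Type u} [AddCommGroup W] [Module R W] {d : ℕ}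
  (hW : IsDualizing (R := R) W d) {rs : List R} (hm : ∀ r ∈ rs, r ∈ maximalIdeal R)
  (hWrs : IsWeaklyRegular W rs) (hR : IsWeaklyRegular R rs) (hl : rs.length = d)
  (hdim : ringKrullDim R = d)
  {X : Type u} [AddCommGroup X] [Module R X] [Module.Finite R X] (hX : IsWeaklyRegular X rs)

include hW

lemma finite_hom (X : Type u) [AddCommGroup X] [Module R X] [Module.Finite R X] :
    Module.Finite R (X →ₗ[R] W) := by
  have := hW.finite
  have : Module.Finite R (ExtMod R X W 0) := ModuleCat.finite_ext R _ _ 0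
  exact Module.Finite.equiv (extZero X W)

include hm hl hX

lemma isHomAcyclic : IsHomAcyclic R W X := fun k ↦
  have := hW.finite
  subsingleton_ext_of_isWeaklyRegular hW.subsingleton_ext hm hX (by lia)

include hWrs hR hdim

lemma isWeaklyRegular_hom_and_length_eq : IsWeaklyRegular (X →ₗ[R] W) rs ∧
    Module.length R ((X →ₗ[R] W) ⧸ (Ideal.ofList rs • ⊤ : Submodule R (X →ₗ[R] W))) =
      Module.length R (X ⧸ (Ideal.ofList rs • ⊤ : Submodule R X)) := by
  obtain ⟨h₁, h₂⟩ := hW.isWeaklyRegular_ext_and_length_eq (rs₀ := []) (k := 0) (Y := X) rfl hm hWrs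
    (by lia) (by simp) hX (isFiniteLength_quotOfList hm hR (hl ▸ hdim) X) fun i hi ↦ by
      obtain ⟨i, rfl⟩ : ∃ j, i = j + 1 := ⟨i - 1, by lia⟩
      exact hW.isHomAcyclic hm hl hX i
  exact ⟨((extZero X W).isWeaklyRegular_congr rs).mp h₁,
    (quotOfListEquiv rs (extZero X W)).length_eq.symm.trans h₂⟩

/-- Evaluation is an isomorphism of a maximal Cohen-Macaulay module with its bidual. -/
theorem bijective_applyₗ :
    Function.Bijective (LinearMap.applyₗ : X →ₗ[R] (X →ₗ[R] W) →ₗ[R] W) := by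
  have hfin := hW.finite_hom X
  have hfin₂ := hW.finite_hom (X →ₗ[R] W)
  have hfin₃ := hW.finite_hom ((X →ₗ[R] W) →ₗ[R] W)
  obtain ⟨h₁, e₁⟩ := hW.isWeaklyRegular_hom_and_length_eq hm hWrs hR hl hdim hX
  obtain ⟨h₂, e₂⟩ := hW.isWeaklyRegular_hom_and_length_eq hm hWrs hR hl hdim h₁
  obtain ⟨h₃, e₃⟩ := hW.isWeaklyRegular_hom_and_length_eq hm hWrs hR hl hdim h₂
  have hfl := isFiniteLength_quotOfList hm hR (hl ▸ hdim)
  let α : X →ₗ[R] (X →ₗ[R] W) →ₗ[R] W := LinearMap.applyₗ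
  let β : (X →ₗ[R] W) →ₗ[R] ((X →ₗ[R] W) →ₗ[R] W) →ₗ[R] W := LinearMap.applyₗ
  let ρ : (((X →ₗ[R] W) →ₗ[R] W) →ₗ[R] W) →ₗ[R] X →ₗ[R] W := α.lcomp R W
  -- The triangle identity: the dual of evaluation on `X` retracts evaluation on `X^∨`.
  have hρβ : ρ ∘ₗ β = LinearMap.id := rfl
  let q {Y Z : Type u} [AddCommGroup Y] [Module R Y] [AddCommGroup Z] [Module R Z]
      (f : Y →ₗ[R] Z) : (Y ⧸ (Ideal.ofList rs • ⊤ : Submodule R Y)) →ₗ[R]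
        (Z ⧸ (Ideal.ofList rs • ⊤ : Submodule R Z)) :=
    Submodule.mapQ _ _ f (Submodule.smul_top_le_comap_smul_top _ f)
  have hq : q ρ ∘ₗ q β = LinearMap.id := by
    ext x
    rfl
  have hβ : Function.Surjective β := by
    -- Modulo `rs`, `β` is still split injective, between modules of the same finite length.
    have hqs := surjective_of_injective_of_length_eq (f := q β)
      (Function.LeftInverse.injective (LinearMap.congr_fun hq)) (by rw [e₃, e₂]) (hfl _)
    refine surjective_of_surjective_mapQ (ofList_le_jacobson hm) β fun y ↦ ?_
    obtain ⟨x, hx⟩ := hqs (Submodule.Quotient.mk y)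
    obtain ⟨x, rfl⟩ := Submodule.mkQ_surjective _ x
    exact ⟨x, (Submodule.Quotient.eq _).mp hx.symm⟩
  have hρ : Function.Bijective ρ := by
    have hβi : Function.Injective β :=
      Function.LeftInverse.injective (g := ρ) (LinearMap.congr_fun hρβ)
    let e := LinearEquiv.ofBijective β ⟨hβi, hβ⟩
    have : ρ = e.symm.toLinearMap := by
      ext1 z
      obtain ⟨y, rfl⟩ := e.surjective z
      rw [LinearEquiv.coe_coe, LinearEquiv.symm_apply_apply]
      rfl
    rw [this]
    exact e.symm.bijective
  have hup {Y : Type u} [AddCommGroup Y] [Module R Y] [Module.Finite R Y]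
      (hY : IsWeaklyRegular Y rs) : ∀ i > 0, Subsingleton (ExtMod R Y W i) := by
    intro i hi
    obtain ⟨i, rfl⟩ : ∃ j, i = j + 1 := ⟨i - 1, by lia⟩
    exact hW.isHomAcyclic hm hl hY i
  refine hW.bijective_of_bijective_extMap hm (k := 0) (by lia) hX h₂ (hfl _) (hfl _)
    (hup hX) (hup h₂) (f := α) ?_
  -- On `Ext^0 = Hom`, the map induced by `α` is the bijection `ρ`.
  have : extMap W α 0 = (extZero X W).symm.toLinearMap ∘ₗ ρ ∘ₗ (extZero _ W).toLinearMap := by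
    ext1 x
    refine (extZero X W).injective ?_
    rw [extZero_extMap]
    simp only [LinearMap.comp_apply, LinearEquiv.coe_coe, LinearEquiv.apply_symm_apply]
    rfl
  rw [this]
  exact (extZero X W).symm.bijective.comp (hρ.comp (extZero _ W).bijective)

end IsDualizing

lemma exists_ringKrullDim_eq [IsNoetherianRing R] : ∃ d : ℕ, ringKrullDim R = d := by
  have := finiteRingKrullDim_iff_ne_bot_and_top.mp (inferInstance : FiniteRingKrullDim R)
  obtain ⟨x, hx⟩ := WithBot.ne_bot_iff_exists.mp this.1
  rw [← hx] at this ⊢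
  obtain ⟨d, rfl⟩ := ENat.ne_top_iff_exists.mp (fun h : x = ⊤ ↦ this.2 (by rw [h]; rfl))
  exact ⟨d, rfl⟩

/-- A canonical module is dualizing. -/
lemma IsCanonicalModule.isDualizing (hR : IsCohenMacaulayLocalRing R) {W : Type u}
    [AddCommGroup W] [Module R W] (hW : IsCanonicalModule R W) {d : ℕ}
    (hdim : ringKrullDim R = d) : IsDualizing (R := R) W d := by
  have := hR.noetherian
  have := hW.maximalCohenMacaulay.finite
  have hdR : depth R R = d := WithBot.coe_injective (hR.depth_eq.trans hdim)
  have hdW : depth R W = d := WithBot.coe_injective (hW.maximalCohenMacaulay.depth_eq.trans hdim)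
  obtain ⟨rs, rfl, hm, hrs⟩ := exists_isWeaklyRegular_of_depth_eq hdR
  obtain ⟨ws, hwl, hwm, hws⟩ := exists_isWeaklyRegular_of_depth_eq hdW
  obtain ⟨b, hb⟩ := hW.finite_injectiveDimension
  refine ⟨this, fun Y _ _ _ i hi ↦ subsingleton_ext_of_finite_injectiveDimension hb hrs
    (fun r hr h ↦ ?_) Y i hi, fun i hi ↦ subsingleton_ext_residueField hwm hws i (hwl ▸ hi), ?_⟩
  · have := length_le_depth (by simpa [or_imp, forall_and] using ⟨hm, hr⟩) h
    rw [hdR, Nat.cast_le, List.length_append, List.length_singleton] at this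
    lia
  · have := hW.type_eq_one
    rwa [moduleType, hdW, ENat.toNat_natCast] at this

section Canonical

variable (hR : IsCohenMacaulayLocalRing R) {W : Type u} [AddCommGroup W] [Module R W]
  (hW : IsCanonicalModule R W) {X : Type u} [AddCommGroup X] [Module R X]

include hR hW

/-- A sequence regular on `X × (W × R)` serves all three modules; the factor `R` keeps the products
nonzero. -/
lemma exists_dualizing_sequence (hX : IsMaximalCohenMacaulay R X) :
    ∃ (d : ℕ) (rs : List R), IsDualizing (R := R) W d ∧ ringKrullDim R = d ∧ rs.length = d ∧
      (∀ r ∈ rs, r ∈ maximalIdeal R) ∧ IsWeaklyRegular W rs ∧ IsWeaklyRegular R rs ∧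
        IsWeaklyRegular X rs := by
  have := hR.noetherian
  have := hX.finite
  obtain ⟨d, hdim⟩ := exists_ringKrullDim_eq (R := R)
  have hWd := hW.isDualizing hR hdim
  have := hWd.finite
  have hseq {Y : Type u} [AddCommGroup Y] [Module R Y]
      (hY : (depth R Y : WithBot ℕ∞) = ringKrullDim R) :=
    exists_isWeaklyRegular_of_depth_eq (M := Y) (WithBot.coe_injective (hY.trans hdim))
  obtain ⟨rs, hl, hm, h⟩ := exists_common_isWeaklyRegular (hseq hX.depth_eq)
    (exists_common_isWeaklyRegular (hseq hW.maximalCohenMacaulay.depth_eq) (hseq hR.depth_eq))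
  exact ⟨d, rs, hWd, hdim, hl, hm, IsWeaklyRegular.fst (IsWeaklyRegular.snd h),
    IsWeaklyRegular.snd (IsWeaklyRegular.snd h), IsWeaklyRegular.fst h⟩

lemma IsMaximalCohenMacaulay.isHomAcyclic (hX : IsMaximalCohenMacaulay R X) :
    IsHomAcyclic R W X := by
  have := hR.noetherian
  have := hX.finite
  obtain ⟨d, rs, hd, hdim, hl, hm, hWrs, hRrs, hXrs⟩ := exists_dualizing_sequence hR hW hX
  exact hd.isHomAcyclic hm hl hXrs

lemma IsMaximalCohenMacaulay.isHomAcyclic_hom (hX : IsMaximalCohenMacaulay R X) :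
    IsHomAcyclic R W (X →ₗ[R] W) := by
  have := hR.noetherian
  have := hX.finite
  obtain ⟨d, rs, hd, hdim, hl, hm, hWrs, hRrs, hXrs⟩ := exists_dualizing_sequence hR hW hX
  have := hd.finite_hom X
  exact hd.isHomAcyclic hm hl
    (hd.isWeaklyRegular_hom_and_length_eq hm hWrs hRrs hl hdim hXrs).1

lemma IsMaximalCohenMacaulay.nonempty_bidual_equiv (hX : IsMaximalCohenMacaulay R X) :
    Nonempty (X ≃ₗ[R] ((X →ₗ[R] W) →ₗ[R] W)) := by
  have := hR.noetherian
  have := hX.finite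
  obtain ⟨d, rs, hd, hdim, hl, hm, hWrs, hRrs, hXrs⟩ := exists_dualizing_sequence hR hW hX
  exact ⟨.ofBijective _ (hd.bijective_applyₗ hm hWrs hRrs hl hdim hXrs)⟩

end Canonical

end CanonicalDuality

end

/-! ### The duality theorem -/

theorem theorem2p1 (R : Type u) [CommRing R] [IsLocalRing R]
    (hR : CanonicalDuality.IsCohenMacaulayLocalRing R)
    (ω : Type u) [AddCommGroup ω] [Module R ω] (hω : CanonicalDuality.IsCanonicalModule R ω)
    (M : Type u) [AddCommGroup M] [Module R M] [Module.Finite R M]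
    (N : Type u) [AddCommGroup N] [Module R N]
    (hN : CanonicalDuality.IsMaximalCohenMacaulay R N)
    (n : ℕ) (hn : 1 ≤ n)
    (hTor : ∀ j < n, Subsingleton (CanonicalDuality.TorMod R M (N →ₗ[R] ω) j) ∨
      CanonicalDuality.IsMaximalCohenMacaulay R (CanonicalDuality.TorMod R M (N →ₗ[R] ω) j)) :
    (∀ j ≤ n, Nonempty (CanonicalDuality.ExtMod R M N j ≃ₗ[R]
      (CanonicalDuality.TorMod R M (N →ₗ[R] ω) j →ₗ[R] ω))) ∧
    (∀ j < n, Nonempty ((CanonicalDuality.ExtMod R M N j →ₗ[R] ω) ≃ₗ[R]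
      CanonicalDuality.TorMod R M (N →ₗ[R] ω) j)) ∧
    ∃ (f₁ : CanonicalDuality.ExtMod R (CanonicalDuality.TorMod R M (N →ₗ[R] ω) n) ω 1 →ₗ[R]
          CanonicalDuality.ExtMod R M N (n + 1))
      (f₂ : CanonicalDuality.ExtMod R M N (n + 1) →ₗ[R]
          (CanonicalDuality.TorMod R M (N →ₗ[R] ω) (n + 1) →ₗ[R] ω))
      (f₃ : (CanonicalDuality.TorMod R M (N →ₗ[R] ω) (n + 1) →ₗ[R] ω) →ₗ[R]
          CanonicalDuality.ExtMod R (CanonicalDuality.TorMod R M (N →ₗ[R] ω) n) ω 2)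
      (f₄ : CanonicalDuality.ExtMod R (CanonicalDuality.TorMod R M (N →ₗ[R] ω) n) ω 2 →ₗ[R]
          CanonicalDuality.ExtMod R M N (n + 2)),
      Function.Injective f₁ ∧ Function.Exact f₁ f₂ ∧ Function.Exact f₂ f₃ ∧
        Function.Exact f₃ f₄ := by
  have := hR.noetherian
  have := hN.finite
  obtain ⟨e⟩ := hN.nonempty_bidual_equiv hR hω
  have hacyclic : ∀ j < n, CanonicalDuality.IsHomAcyclic R ω
      (CanonicalDuality.TorMod R M (N →ₗ[R] ω) j) := fun j hj ↦
    (hTor j hj).elim (fun _ _ ↦ CanonicalDuality.subsingleton_extMod ω _)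
      fun h ↦ h.isHomAcyclic hR hω
  obtain ⟨h₁, h₂⟩ := CanonicalDuality.ext_tor_duality (M := M) e (hN.isHomAcyclic_hom hR hω) hn
    hacyclic
  refine ⟨h₁, fun j hj ↦ ?_, h₂⟩
  obtain ⟨ε⟩ := h₁ j hj.le
  -- If `Tor_j` is zero, so is `Ext^j`, and the zero map is an equivalence; otherwise dualize `ε`
  -- and apply biduality to `Tor_j`.
  refine (hTor j hj).elim (fun _ ↦ ?_) fun h ↦ ?_
  · have := ε.toEquiv.subsingleton
    exact ⟨0⟩
  · obtain ⟨b⟩ := h.nonempty_bidual_equiv hR hω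
    exact ⟨LinearEquiv.congrLeft ω R ε ≪≫ₗ b.symm⟩
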